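/- Let $d,\alpha,\gamma\in\mathbb R$ with $\gamma\neq 0$ and $(d,\alpha)\in \mathrm P$, where $$\mathrm P=\Big\{(d,\alpha)\;:\; 0<d\le 1,\ 4-d<\alpha\Big\}\cup\Big\{(d,\alpha)\;:\;1<d<2,\ 4-d<\alpha<\tfrac{d}{d-1}\Big\},$$ and set $$s_A=4,\qquad s_U=2\sqrt{d\alpha},\qquad s_{AU}=d\sqrt{\frac{\alpha-2}{2-d}}+\alpha\sqrt{\frac{2-d}{\alpha-2}} .$$ Then $s_{AU}>\max\{s_A,s_U\}$. Moreover, let $(U,A)$ be a solution of $$U_t=dU_{xx}+(\alpha-6A^2)U-U^3+2\gamma A^2,\qquad A_t=4A_{xx}+A-3A^3,\qquad t>0,\ x\in\mathbb R,$$ that is of class $C^{1,2}$ (once in $t$, twice in $x$) on $(0,\infty)\times\mathbb R$, bounded on $(0,T]\times\mathbb R$ for every $T>0$, and such that $U(t,\cdot)\to U_0$ and $A(t,\cdot)\to A_0$ in $L^1_{\mathrm{loc}}(\mathbb R)$ as $t\to0^+$. Assume that $A_0$ and $\operatorname{sgn}(\gamma)\,U_0$ are nonnegative and that each is the sum of a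 Heaviside step function $h\,H(-x)$ of some height $h>0$ (equal to $h$ for $x<0$ and $0$ for $x\ge0$; the two heights may differ) and a bounded measurable function with compact support. Define the invasion point $$\kappa(t)=\sup\{x\in\mathbb R\;:\;\operatorname{sgn}(\gamma)\,U(t,x)>\sqrt{\alpha-2}\},$$ that is, $\kappa(t)=\sup\{x: U(t,x)>\sqrt{\alpha-2}\}$ when $\gamma>0$. Then for all sufficiently large $t$ this set is nonempty and bounded above, and $$\lim_{t\to\infty}\frac{\kappa(t)}{t}=s_{AU}.$$ -/

import Mathlib

open Filter Topology MeasureTheory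

/-- The parameter region of pairs `(d, α)`. -/
def regionP : Set (ℝ × ℝ) :=
  {p | (0 < p.1 ∧ p.1 ≤ 1 ∧ 4 - p.1 < p.2) ∨
       (1 < p.1 ∧ p.1 < 2 ∧ 4 - p.1 < p.2 ∧ p.2 < p.1 / (p.1 - 1))}

/-- The speed `s_AU` of the `U` mode induced by the quadratic coupling to the `A` mode. -/
noncomputable def speedAU (d α : ℝ) : ℝ :=
  d * Real.sqrt ((α - 2) / (2 - d)) + α * Real.sqrt ((2 - d) / (α - 2))

/-- The speed `s_A` of the Turing mode. -/
noncomputable def speedA : ℝ := 4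

/-- The speed `s_U` of the zero mode. -/
noncomputable def speedU (d α : ℝ) : ℝ := 2 * Real.sqrt (d * α)

/-- A nonnegative function which is a bounded measurable compactly supported perturbation of a
Heaviside step function `h H(-x)` of some height `h > 0`. -/
def IsPerturbedStep (f : ℝ → ℝ) : Prop :=
  (∀ x, 0 ≤ f x) ∧
  ∃ h : ℝ, 0 < h ∧ ∃ p : ℝ → ℝ, Measurable p ∧ (∃ M, ∀ x, |p x| ≤ M) ∧ HasCompactSupport p ∧
    ∀ x, f x = (if x < 0 then h else 0) + p x

/-- `u t x` is of class `C^{1,2}` (once in time, twice in space) on `(0, ∞) × ℝ`. -/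
structure IsC12 (u : ℝ → ℝ → ℝ) : Prop where
  diff_time : ∀ t > 0, ∀ x, DifferentiableAt ℝ (fun s => u s x) t
  diff_space : ∀ t > 0, ∀ x, DifferentiableAt ℝ (u t) x
  diff_space_two : ∀ t > 0, ∀ x, DifferentiableAt ℝ (deriv (u t)) x
  cont : ContinuousOn (fun z : ℝ × ℝ => u z.1 z.2) (Set.Ioi 0 ×ˢ Set.univ)
  cont_time : ContinuousOn (fun z : ℝ × ℝ => deriv (fun s => u s z.2) z.1)
    (Set.Ioi 0 ×ˢ Set.univ)
  cont_space : ContinuousOn (fun z : ℝ × ℝ => deriv (u z.1) z.2) (Set.Ioi 0 ×ˢ Set.univ)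
  cont_space_two : ContinuousOn (fun z : ℝ × ℝ => deriv (deriv (u z.1)) z.2)
    (Set.Ioi 0 ×ˢ Set.univ)

/-- `u` is bounded on every strip `(0, T] × ℝ`. -/
def BoundedOnStrips (u : ℝ → ℝ → ℝ) : Prop :=
  ∀ T : ℝ, ∃ M : ℝ, ∀ t, 0 < t → t ≤ T → ∀ x, |u t x| ≤ M

/-- `u` takes the (possibly discontinuous) initial value `u0` in the sense of `L¹_loc`. -/
def HasInitialValue (u : ℝ → ℝ → ℝ) (u0 : ℝ → ℝ) : Prop :=
  ∀ R : ℝ, Tendsto (fun t => ∫ x in Set.Icc (-R) R, |u t x - u0 x|) (𝓝[>] 0) (𝓝 0)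

/-- `(U, A)` is the solution, classical for positive times and bounded on strips, of
`U_t = d U_xx + (α - 6 A²) U - U³ + 2 γ A²`, `A_t = 4 A_xx + A - 3 A³`
with initial data `(U0, A0)`. -/
structure IsSolution (d α γ : ℝ) (U A : ℝ → ℝ → ℝ) (U0 A0 : ℝ → ℝ) : Prop where
  regU : IsC12 U
  regA : IsC12 A
  bddU : BoundedOnStrips U
  bddA : BoundedOnStrips A
  eqU : ∀ t > 0, ∀ x, deriv (fun s => U s x) t =
    d * deriv (deriv (U t)) x + (α - 6 * A t x ^ 2) * U t x - U t x ^ 3 + 2 * γ * A t x ^ 2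
  eqA : ∀ t > 0, ∀ x, deriv (fun s => A s x) t =
    4 * deriv (deriv (A t)) x + A t x - 3 * A t x ^ 3
  initU : HasInitialValue U U0
  initA : HasInitialValue A A0

/-- The points at which `u(t, ·)` exceeds the threshold `√(α - 2)`. -/
def invadedSet (α : ℝ) (u : ℝ → ℝ → ℝ) (t : ℝ) : Set ℝ :=
  {x | Real.sqrt (α - 2) < u t x}

/-- The invasion point `κ(t)`. -/
noncomputable def invasionPoint (α : ℝ) (u : ℝ → ℝ → ℝ) (t : ℝ) : ℝ :=
  sSup (invadedSet α u t)

/-!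
The sign of `γ` is absorbed by reflecting `U`: `V = sgn(γ) U` solves the system with the coupling
`g = |γ| > 0`, and `V` and `A` stay nonnegative. Everything rests on a comparison principle for
functions bounded above whose positive part vanishes initially only in `L¹_loc`
(`nonpos_of_subsolution`), proved by a weighted energy estimate for `(w⁺)³`, which is `C²` in `w`.

Put `p = √((α - 2)/(2 - d))`. The parameter region says that `p > 1` and `dp² < α`, and `p` is the
decay rate at which two dispersion relations agree: an exponential `e^{-px}` in the linearised
`V` equation grows at the rate `dp² + α`, the square `A²` of the linearised solution
`e^{-px/2}` grows at the rate `2p² + 2`, and both equal `p s_AU`.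

Upper bound. `A ≤ C e^{-px/2 + (p² + 1)t}`, so `A²` forces `V` resonantly and
`V ≤ (C + Bt) e^{-p(x - s_AU t)}` (`exists_V_le`). This tends to `0` uniformly on
`x ≥ (s_AU + ε)t`.

Lower bound. The optimal path to the invasion point has two phases. During a time `τ` it follows
`A` at the speed `4p`, faster than the `A` front; there `A² ≈ e^{-2(p² - 1)τ}`, and the source
`2gA²` gives `V` the same size (`exists_A_ge`, `exists_V_ge`). Then it follows `V` at the speed
`2dp`, along which `V` grows at the rate `α - dp²` (`V_growth`), until `V` is of order one; a bounded
further time brings `V` above `√(α - 2)`, because `A` is negligible there and the equilibrium is `√α`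
(`exists_invaded`). The average speed of this path is `dp + α/p = s_AU` up to an arbitrarily small
loss (`tendsto_two_speed`). All lower bounds are compactly supported bumps
`m(t) e^{-ay} ((1 - (y/L)²)⁺)³` moving at speed `c`, for which the choice `a = c/(2D)` makes the
growth rate `ρ - c²/(4D) - 10D/L²` available (`bump_le_of_supersolution`).
-/

/-! ### Powers of the positive part -/

/-- The powers `(x⁺)ⁿ⁺²` are differentiable across `0`; this makes `(x⁺)³` of class `C²`. -/
lemma hasDerivAt_posPart_pow (n : ℕ) (x : ℝ) :
    HasDerivAt (fun x : ℝ => (max x 0) ^ (n + 2)) ((n + 2) * (max x 0) ^ (n + 1)) x := by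
  rcases lt_trichotomy x 0 with hx | rfl | hx
  · have h : (fun x : ℝ => (max x 0) ^ (n + 2)) =ᶠ[𝓝 x] fun _ => (0 : ℝ) := by
      filter_upwards [Iio_mem_nhds hx] with y hy
      rw [max_eq_right (le_of_lt hy)]; simp
    rw [max_eq_right hx.le]
    simpa using (hasDerivAt_const x (0 : ℝ)).congr_of_eventuallyEq h
  · have h : (fun x : ℝ => (max x 0) ^ (n + 2)) =O[𝓝 0] fun x => ‖x - 0‖ ^ (n + 2) := by
      refine Asymptotics.IsBigO.of_bound 1 (Eventually.of_forall fun y => ?_)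
      have h0 : 0 ≤ max y 0 := le_max_right _ _
      rw [one_mul, norm_pow, norm_pow, norm_norm, sub_zero]
      refine pow_le_pow_left₀ (norm_nonneg _) ?_ _
      rw [Real.norm_of_nonneg h0, Real.norm_eq_abs]
      exact max_le (le_abs_self y) (abs_nonneg y)
    simpa using (h.hasFDerivAt (by omega)).hasDerivAt
  · have h : (fun x : ℝ => (max x 0) ^ (n + 2)) =ᶠ[𝓝 x] fun y => y ^ (n + 2) := by
      filter_upwards [Ioi_mem_nhds hx] with y hy
      rw [max_eq_left (le_of_lt hy)]
    rw [max_eq_left hx.le]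
    simpa using (hasDerivAt_pow (n + 2) x).congr_of_eventuallyEq h

lemma hasDerivAt_posPart_cube (x : ℝ) :
    HasDerivAt (fun x : ℝ => (max x 0) ^ 3) (3 * (max x 0) ^ 2) x := by
  convert hasDerivAt_posPart_pow 1 x using 1
  norm_num

lemma hasDerivAt_posPart_sq (x : ℝ) :
    HasDerivAt (fun x : ℝ => (max x 0) ^ 2) (2 * max x 0) x := by
  convert hasDerivAt_posPart_pow 0 x using 1
  norm_num

/-! ### Classical regularity and the comparison principle -/

/-- `w` has, for times after `t₀`, the time derivative `wt` and the space derivatives `wx`, `wxx`,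
with the continuity needed to differentiate integrals of `w` over compact intervals. -/
structure ClassicalAfter (t₀ : ℝ) (w wt wx wxx : ℝ → ℝ → ℝ) : Prop where
  time : ∀ t > t₀, ∀ x, HasDerivAt (fun s => w s x) (wt t x) t
  space : ∀ t > t₀, ∀ x, HasDerivAt (w t) (wx t x) x
  space_two : ∀ t > t₀, ∀ x, HasDerivAt (wx t) (wxx t x) x
  cont : ContinuousOn (fun z : ℝ × ℝ => w z.1 z.2) (Set.Ioi t₀ ×ˢ Set.univ)
  cont_time : ContinuousOn (fun z : ℝ × ℝ => wt z.1 z.2) (Set.Ioi t₀ ×ˢ Set.univ)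
  cont_space_two : ∀ t > t₀, Continuous (wxx t)

lemma continuous_slice {t₀ : ℝ} {f : ℝ → ℝ → ℝ}
    (hf : ContinuousOn (fun z : ℝ × ℝ => f z.1 z.2) (Set.Ioi t₀ ×ˢ Set.univ)) {t : ℝ}
    (ht : t₀ < t) : Continuous (f t) := by
  rw [continuous_iff_continuousAt]
  intro x
  have h : ContinuousAt (fun z : ℝ × ℝ => f z.1 z.2) (t, x) :=
    hf.continuousAt (prod_mem_nhds (Ioi_mem_nhds ht) univ_mem)
  exact h.comp (f := fun x => (t, x)) (by fun_prop)

namespace ClassicalAfter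

variable {t₀ : ℝ} {w wt wx wxx v vt vx vxx : ℝ → ℝ → ℝ}

lemma mono (h : ClassicalAfter t₀ w wt wx wxx) {t₁ : ℝ} (h01 : t₀ ≤ t₁) :
    ClassicalAfter t₁ w wt wx wxx where
  time t ht := h.time t (h01.trans_lt ht)
  space t ht := h.space t (h01.trans_lt ht)
  space_two t ht := h.space_two t (h01.trans_lt ht)
  cont := h.cont.mono (Set.prod_mono (Set.Ioi_subset_Ioi h01) le_rfl)
  cont_time := h.cont_time.mono (Set.prod_mono (Set.Ioi_subset_Ioi h01) le_rfl)
  cont_space_two t ht := h.cont_space_two t (h01.trans_lt ht)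

lemma sub (h : ClassicalAfter t₀ w wt wx wxx) (k : ClassicalAfter t₀ v vt vx vxx) :
    ClassicalAfter t₀ (fun t x => w t x - v t x) (fun t x => wt t x - vt t x)
      (fun t x => wx t x - vx t x) (fun t x => wxx t x - vxx t x) where
  time t ht x := (h.time t ht x).sub (k.time t ht x)
  space t ht x := (h.space t ht x).sub (k.space t ht x)
  space_two t ht x := (h.space_two t ht x).sub (k.space_two t ht x)
  cont := h.cont.sub k.cont
  cont_time := h.cont_time.sub k.cont_time
  cont_space_two t ht := (h.cont_space_two t ht).sub (k.cont_space_two t ht)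

lemma neg (h : ClassicalAfter t₀ w wt wx wxx) :
    ClassicalAfter t₀ (fun t x => -w t x) (fun t x => -wt t x)
      (fun t x => -wx t x) (fun t x => -wxx t x) where
  time t ht x := (h.time t ht x).neg
  space t ht x := (h.space t ht x).neg
  space_two t ht x := (h.space_two t ht x).neg
  cont := h.cont.neg
  cont_time := h.cont_time.neg
  cont_space_two t ht := (h.cont_space_two t ht).neg

lemma cont_slice (h : ClassicalAfter t₀ w wt wx wxx) {t : ℝ} (ht : t₀ < t) : Continuous (w t) :=
  continuous_slice h.cont ht

lemma cont_time_slice (h : ClassicalAfter t₀ w wt wx wxx) {t : ℝ} (ht : t₀ < t) :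
    Continuous (wt t) :=
  continuous_slice h.cont_time ht

lemma cont_space_slice (h : ClassicalAfter t₀ w wt wx wxx) {t : ℝ} (ht : t₀ < t) :
    Continuous (wx t) :=
  continuous_iff_continuousAt.2 fun x => (h.space_two t ht x).continuousAt

/-- Differentiation under the integral for the weighted cubic energy. -/
lemma hasDerivAt_energy (h : ClassicalAfter t₀ w wt wx wxx) {φ : ℝ → ℝ} (hφ : Continuous φ)
    (R : ℝ) {t : ℝ} (ht : t₀ < t) :
    HasDerivAt (fun s => ∫ x in (-R)..R, φ x * (max (w s x) 0) ^ 3)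
      (∫ x in (-R)..R, φ x * (3 * (max (w t x) 0) ^ 2 * wt t x)) t := by
  set a := (t₀ + t) / 2 with ha
  have hat : t₀ < a := by rw [ha]; linarith
  have hat' : a < t := by rw [ha]; linarith
  set K : Set (ℝ × ℝ) := Set.Icc a (t + 1) ×ˢ Set.uIcc (-R) R with hK
  have hKc : IsCompact K := isCompact_Icc.prod isCompact_uIcc
  have hsub : K ⊆ Set.Ioi t₀ ×ˢ Set.univ := fun z hz =>
    ⟨lt_of_lt_of_le hat hz.1.1, Set.mem_univ _⟩
  have hw := h.cont.mono hsub
  have hwt := h.cont_time.mono hsub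
  have hcont : ContinuousOn
      (fun z : ℝ × ℝ => φ z.2 * (3 * (max (w z.1 z.2) 0) ^ 2 * wt z.1 z.2)) K :=
    (by fun_prop : Continuous fun z : ℝ × ℝ => φ z.2).continuousOn.mul
      (((hw.sup continuousOn_const).pow 2 |>.const_mul 3 |>.mul hwt))
  obtain ⟨B, hB⟩ := hKc.exists_bound_of_continuousOn hcont
  have hcs : ∀ s > t₀, Continuous fun x => φ x * (max (w s x) 0) ^ 3 := fun s hs =>
    hφ.mul (((h.cont_slice hs).max continuous_const).pow 3)
  have hct : Continuous fun x => φ x * (3 * (max (w t x) 0) ^ 2 * wt t x) := by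
    have h1 := h.cont_slice ht
    have h2 := h.cont_time_slice ht
    fun_prop
  refine (intervalIntegral.hasDerivAt_integral_of_dominated_loc_of_deriv_le
    (F := fun s x => φ x * (max (w s x) 0) ^ 3)
    (F' := fun s x => φ x * (3 * (max (w s x) 0) ^ 2 * wt s x)) (bound := fun _ => B)
    (s := Set.Icc a (t + 1)) (Icc_mem_nhds hat' (by linarith)) ?_ ?_ ?_ ?_ ?_ ?_).2
  · filter_upwards [Ioi_mem_nhds ht] with s hs
    exact (hcs s hs).aestronglyMeasurable
  · exact (hcs t ht).intervalIntegrable _ _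
  · exact hct.aestronglyMeasurable
  · exact Eventually.of_forall fun x hx s hs =>
      hB (s, x) ⟨hs, Set.uIoc_subset_uIcc hx⟩
  · exact _root_.intervalIntegrable_const
  · refine Eventually.of_forall fun x _ s hs => ?_
    exact ((hasDerivAt_posPart_cube (w s x)).comp s
      (h.time s (hat.trans_le hs.1) x)).const_mul (φ x)

/-- Green's identity for `(w⁺)³` against the weight `(R² - x²)³`, which vanishes to third order at
`±R`, so that no boundary terms appear. -/
lemma integral_weight_mul_second_deriv (h : ClassicalAfter t₀ w wt wx wxx) (R : ℝ) {t : ℝ}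
    (ht : t₀ < t) :
    ∫ x in (-R)..R, (R ^ 2 - x ^ 2) ^ 3 *
        (3 * (max (w t x) 0) ^ 2 * wxx t x + 6 * max (w t x) 0 * wx t x ^ 2) =
      ∫ x in (-R)..R, (24 * x ^ 2 * (R ^ 2 - x ^ 2) - 6 * (R ^ 2 - x ^ 2) ^ 2) *
        (max (w t x) 0) ^ 3 := by
  have h1 := h.cont_slice ht
  have h2 := h.cont_space_slice ht
  have h3 := h.cont_space_two t ht
  have key : ∀ x ∈ Set.uIcc (-R) R, HasDerivAt
      (fun x => (R ^ 2 - x ^ 2) ^ 3 * (3 * (max (w t x) 0) ^ 2 * wx t x)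
        + 6 * x * (R ^ 2 - x ^ 2) ^ 2 * (max (w t x) 0) ^ 3)
      ((R ^ 2 - x ^ 2) ^ 3 *
        (3 * (max (w t x) 0) ^ 2 * wxx t x + 6 * max (w t x) 0 * wx t x ^ 2) -
        (24 * x ^ 2 * (R ^ 2 - x ^ 2) - 6 * (R ^ 2 - x ^ 2) ^ 2) *
        (max (w t x) 0) ^ 3) x := by
    intro x _
    have e1 := (hasDerivAt_posPart_cube (w t x)).comp x (h.space t ht x)
    have e2 := (hasDerivAt_posPart_sq (w t x)).comp x (h.space t ht x)
    have e0 : HasDerivAt (fun x : ℝ => R ^ 2 - x ^ 2) (-(2 * x)) x := by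
      simpa using (hasDerivAt_pow 2 x).const_sub (R ^ 2)
    have e := ((e0.pow 3).mul ((e2.const_mul 3).mul (h.space_two t ht x))).add
      ((((hasDerivAt_id x).const_mul 6).mul (e0.pow 2)).mul e1)
    refine HasDerivAt.congr_deriv (f := _) e ?_
    simp only [Pi.pow_apply, Pi.mul_apply, Function.comp_apply, id]
    push_cast
    ring
  have hint := intervalIntegral.integral_eq_sub_of_hasDerivAt key
    (Continuous.intervalIntegrable (by fun_prop) _ _)
  rw [intervalIntegral.integral_sub (Continuous.intervalIntegrable (by fun_prop) _ _)
    (Continuous.intervalIntegrable (by fun_prop) _ _)] at hint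
  have hz : R ^ 2 - (-R) ^ 2 = 0 := by ring
  rw [hz] at hint
  simp only [sub_self] at hint
  linarith [hint]

end ClassicalAfter

/-- Gronwall's inequality on a half-open interval, with vanishing limit at the left end. -/
lemma gronwall_of_tendsto_zero {t₀ T K c : ℝ} (hc : 0 ≤ c) (hK : 0 ≤ K) {E E' : ℝ → ℝ}
    (hE : ∀ t > t₀, HasDerivAt E (E' t) t)
    (hE' : ∀ t, t₀ < t → t ≤ T → E' t ≤ K * E t + c)
    (h0 : Tendsto E (𝓝[>] t₀) (𝓝 0)) {t : ℝ} (ht : t₀ < t) (htT : t ≤ T) :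
    E t ≤ Real.exp (K * (t - t₀)) * (c * (t - t₀)) := by
  set F : ℝ → ℝ := fun s => Real.exp (-(K * (s - t₀))) * E s - c * (s - t₀) with hF
  have hd : ∀ s > t₀, HasDerivAt F (Real.exp (-(K * (s - t₀))) * (-K) * E s
      + Real.exp (-(K * (s - t₀))) * E' s - c) s := by
    intro s hs
    have e1 : HasDerivAt (fun s : ℝ => s - t₀) 1 s := (hasDerivAt_id s).sub_const t₀
    have e2 := ((e1.const_mul K).neg.exp).mul (hE s hs)
    have e3 := e2.sub (e1.const_mul c)
    refine HasDerivAt.congr_deriv (f := _) e3 ?_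
    simp only [Pi.neg_apply]
    ring
  have hanti : AntitoneOn F (Set.Ioc t₀ t) := by
    refine antitoneOn_of_deriv_nonpos (convex_Ioc t₀ t)
      (fun s hs => (hd s hs.1).continuousAt.continuousWithinAt) ?_ ?_
    · intro s hs
      rw [interior_Ioc] at hs
      exact (hd s hs.1).differentiableAt.differentiableWithinAt
    · intro s hs
      rw [interior_Ioc] at hs
      rw [(hd s hs.1).deriv]
      have h1 := hE' s hs.1 (hs.2.le.trans htT)
      have h2 : Real.exp (-(K * (s - t₀))) ≤ 1 := by
        rw [Real.exp_le_one_iff]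
        have := hs.1
        have : 0 ≤ K * (s - t₀) := mul_nonneg hK (by linarith)
        linarith
      have h3 := mul_le_mul_of_nonneg_left h1 (Real.exp_pos (-(K * (s - t₀)))).le
      have h4 := mul_le_mul_of_nonneg_right h2 hc
      nlinarith
  have hlim : Tendsto F (𝓝[>] t₀) (𝓝 0) := by
    have e1 : Tendsto (fun s : ℝ => Real.exp (-(K * (s - t₀)))) (𝓝[>] t₀) (𝓝 1) := by
      have : Continuous fun s : ℝ => Real.exp (-(K * (s - t₀))) := by fun_prop
      have := (this.tendsto t₀).mono_left (nhdsWithin_le_nhds (s := Set.Ioi t₀))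
      simpa using this
    have e2 : Tendsto (fun s : ℝ => c * (s - t₀)) (𝓝[>] t₀) (𝓝 0) := by
      have : Continuous fun s : ℝ => c * (s - t₀) := by fun_prop
      have := (this.tendsto t₀).mono_left (nhdsWithin_le_nhds (s := Set.Ioi t₀))
      simpa using this
    simpa using (e1.mul h0).sub e2
  have hle : F t ≤ 0 := by
    refine ge_of_tendsto hlim ?_
    filter_upwards [Ioo_mem_nhdsGT ht] with s hs
    exact hanti ⟨hs.1, hs.2.le⟩ ⟨ht, le_rfl⟩ hs.2.le
  have h5 : Real.exp (-(K * (t - t₀))) * E t ≤ c * (t - t₀) := by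
    simp only [hF] at hle; linarith
  calc E t = Real.exp (K * (t - t₀)) * (Real.exp (-(K * (t - t₀))) * E t) := by
        rw [← mul_assoc, ← Real.exp_add]; simp
    _ ≤ _ := mul_le_mul_of_nonneg_left h5 (Real.exp_pos _).le

/-- Comparison principle on the line for classical functions that are bounded above and whose
positive part vanishes initially in `L¹_loc` only. The weighted energy
`E = ∫ (R² - x²)³ (w⁺)³` over `[-R, R]` satisfies `E' ≤ 3KE + O(R⁵)`, while its weight is of order
`R⁶` on each fixed interval, so that letting `R → ∞` gives `w⁺ = 0`. -/
theorem nonpos_of_subsolution {t₀ T D K M : ℝ} (hD : 0 ≤ D) (hK : 0 ≤ K)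
    {w wt wx wxx : ℝ → ℝ → ℝ} (h : ClassicalAfter t₀ w wt wx wxx)
    (hM : ∀ t, t₀ < t → t ≤ T → ∀ x, w t x ≤ M)
    (hpde : ∀ t, t₀ < t → t ≤ T → ∀ x, 0 < w t x → wt t x ≤ D * wxx t x + K * w t x)
    (h0 : ∀ R > 0, Tendsto (fun t => ∫ x in (-R)..R, max (w t x) 0) (𝓝[>] t₀) (𝓝 0))
    {t : ℝ} (ht : t₀ < t) (htT : t ≤ T) (x : ℝ) : w t x ≤ 0 := by
  set N := max M 0 with hN
  have hN0 : 0 ≤ N := le_max_right _ _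
  have hwN : ∀ s, t₀ < s → s ≤ T → ∀ y, max (w s y) 0 ≤ N := fun s hs hsT y =>
    max_le_max (hM s hs hsT y) le_rfl
  have hp0 : ∀ s y, 0 ≤ max (w s y) 0 := fun s y => le_max_right _ _
  have hweight : ∀ R : ℝ, ∀ y ∈ Set.Icc (-R) R, 0 ≤ R ^ 2 - y ^ 2 := by
    intro R y hy
    have := abs_le.2 hy
    nlinarith [sq_abs y, abs_nonneg y]
  have energy : ∀ R > 0, ∫ y in (-R)..R, (R ^ 2 - y ^ 2) ^ 3 * (max (w t y) 0) ^ 3 ≤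
      Real.exp (3 * K * (t - t₀)) * (D * (12 * R ^ 5 * N ^ 3) * (t - t₀)) := by
    intro R hR
    have hRR : -R ≤ R := by linarith
    refine gronwall_of_tendsto_zero (T := T)
      (E := fun s => ∫ y in (-R)..R, (R ^ 2 - y ^ 2) ^ 3 * (max (w s y) 0) ^ 3)
      (by positivity) (by positivity)
      (fun s hs => h.hasDerivAt_energy (φ := fun y => (R ^ 2 - y ^ 2) ^ 3) (by fun_prop) R hs)
      ?_ ?_ ht htT
    · intro s hs hsT
      have c1 := h.cont_slice hs
      have c2 := h.cont_space_slice hs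
      have c3 := h.cont_space_two s hs
      have c4 := h.cont_time_slice hs
      have step1 : ∫ y in (-R)..R, (R ^ 2 - y ^ 2) ^ 3 * (3 * (max (w s y) 0) ^ 2 * wt s y) ≤
          ∫ y in (-R)..R, (D * ((R ^ 2 - y ^ 2) ^ 3 *
            (3 * (max (w s y) 0) ^ 2 * wxx s y + 6 * max (w s y) 0 * wx s y ^ 2)) +
            3 * K * ((R ^ 2 - y ^ 2) ^ 3 * (max (w s y) 0) ^ 3)) := by
        refine intervalIntegral.integral_mono_on hRR
          (Continuous.intervalIntegrable (by fun_prop) _ _)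
          (Continuous.intervalIntegrable (by fun_prop) _ _) fun y hy => ?_
        have hq := pow_nonneg (hweight R y hy) 3
        have hp := hp0 s y
        rcases le_or_gt (w s y) 0 with hw | hw
        · rw [max_eq_right hw]; simp
        · rw [max_eq_left hw.le] at hp ⊢
          have h1 := hpde s hs hsT y hw
          have h2 : 3 * w s y ^ 2 * wt s y ≤ D * (3 * w s y ^ 2 * wxx s y +
              6 * w s y * wx s y ^ 2) + 3 * K * w s y ^ 3 := by
            have h3 := mul_le_mul_of_nonneg_left h1 (by positivity : 0 ≤ 3 * w s y ^ 2)
            have h4 : 0 ≤ D * (6 * w s y * wx s y ^ 2) := by positivity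
            nlinarith
          have h5 := mul_le_mul_of_nonneg_left h2 hq
          linarith
      have step2 : ∫ y in (-R)..R,
          (24 * y ^ 2 * (R ^ 2 - y ^ 2) - 6 * (R ^ 2 - y ^ 2) ^ 2) * (max (w s y) 0) ^ 3 ≤
          ∫ y in (-R)..R, 6 * R ^ 4 * N ^ 3 := by
        refine intervalIntegral.integral_mono_on hRR
          (Continuous.intervalIntegrable (by fun_prop) _ _)
          (Continuous.intervalIntegrable (by fun_prop) _ _) fun y hy => ?_
        have h1 : 24 * y ^ 2 * (R ^ 2 - y ^ 2) - 6 * (R ^ 2 - y ^ 2) ^ 2 ≤ 6 * R ^ 4 := by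
          nlinarith [sq_nonneg (R ^ 2 - 2 * y ^ 2), sq_nonneg (R ^ 2 - y ^ 2)]
        calc _ ≤ 6 * R ^ 4 * (max (w s y) 0) ^ 3 :=
              mul_le_mul_of_nonneg_right h1 (pow_nonneg (hp0 s y) 3)
          _ ≤ _ := mul_le_mul_of_nonneg_left
              (pow_le_pow_left₀ (hp0 s y) (hwN s hs hsT y) 3) (by positivity)
      rw [intervalIntegral.integral_add (Continuous.intervalIntegrable (by fun_prop) _ _)
        (Continuous.intervalIntegrable (by fun_prop) _ _), intervalIntegral.integral_const_mul,
        intervalIntegral.integral_const_mul, h.integral_weight_mul_second_deriv R hs] at step1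
      rw [intervalIntegral.integral_const, smul_eq_mul] at step2
      have step3 := mul_le_mul_of_nonneg_left step2 hD
      linarith
    · have hlim : Tendsto (fun s => R ^ 6 * N ^ 2 * ∫ y in (-R)..R, max (w s y) 0)
          (𝓝[>] t₀) (𝓝 0) := by simpa using (h0 R hR).const_mul (R ^ 6 * N ^ 2)
      refine squeeze_zero' (Eventually.of_forall fun s => ?_) ?_ hlim
      · exact intervalIntegral.integral_nonneg hRR fun y hy =>
          mul_nonneg (pow_nonneg (hweight R y hy) 3) (pow_nonneg (hp0 s y) 3)
      · filter_upwards [Ioo_mem_nhdsGT ht] with s hs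
        have c1 := h.cont_slice hs.1
        rw [← intervalIntegral.integral_const_mul]
        refine intervalIntegral.integral_mono_on hRR
          (Continuous.intervalIntegrable (by fun_prop) _ _)
          (Continuous.intervalIntegrable (by fun_prop) _ _) fun y hy => ?_
        have h1 : (R ^ 2 - y ^ 2) ^ 3 ≤ R ^ 6 := by
          calc (R ^ 2 - y ^ 2) ^ 3 ≤ (R ^ 2) ^ 3 :=
                pow_le_pow_left₀ (hweight R y hy) (by nlinarith [sq_nonneg y]) 3
            _ = R ^ 6 := by ring
        have h2 : (max (w s y) 0) ^ 2 ≤ N ^ 2 :=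
          pow_le_pow_left₀ (hp0 s y) (hwN s hs.1 (hs.2.le.trans htT) y) 2
        calc (R ^ 2 - y ^ 2) ^ 3 * (max (w s y) 0) ^ 3
            ≤ R ^ 6 * (max (w s y) 0) ^ 3 :=
              mul_le_mul_of_nonneg_right h1 (pow_nonneg (hp0 s y) 3)
          _ = R ^ 6 * (max (w s y) 0 ^ 2 * max (w s y) 0) := by ring
          _ ≤ R ^ 6 * (N ^ 2 * max (w s y) 0) :=
              mul_le_mul_of_nonneg_left (mul_le_mul_of_nonneg_right h2 (hp0 s y)) (by positivity)
          _ = _ := by ring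
  by_contra! hpos
  have c1 := h.cont_slice ht
  set I := ∫ y in (x - 1)..(x + 1), (max (w t y) 0) ^ 3 with hI
  have hIpos : 0 < I := by
    refine intervalIntegral.integral_pos (by linarith)
      (Continuous.continuousOn (by fun_prop)) (fun y _ => pow_nonneg (hp0 t y) 3)
      ⟨x, ⟨by linarith, by linarith⟩, ?_⟩
    rw [max_eq_left hpos.le]; positivity
  set C := Real.exp (3 * K * (t - t₀)) * (D * (12 * N ^ 3) * (t - t₀)) with hC
  have hmain : ∀ R ≥ 2 * (|x| + 1), (27 / 64) * R * I ≤ C := by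
    intro R hR
    have hx := abs_nonneg x
    have hR0 : 0 < R := by linarith
    have hx1 := le_abs_self x
    have hx2 := neg_abs_le x
    have lower : (27 / 64) * R ^ 6 * I ≤
        ∫ y in (-R)..R, (R ^ 2 - y ^ 2) ^ 3 * (max (w t y) 0) ^ 3 := by
      calc (27 / 64) * R ^ 6 * I
          = ∫ y in (x - 1)..(x + 1), (27 / 64) * R ^ 6 * (max (w t y) 0) ^ 3 := by
            rw [intervalIntegral.integral_const_mul]
        _ ≤ ∫ y in (x - 1)..(x + 1), (R ^ 2 - y ^ 2) ^ 3 * (max (w t y) 0) ^ 3 := by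
            refine intervalIntegral.integral_mono_on (by linarith)
              (Continuous.intervalIntegrable (by fun_prop) _ _)
              (Continuous.intervalIntegrable (by fun_prop) _ _) fun y hy => ?_
            refine mul_le_mul_of_nonneg_right ?_ (pow_nonneg (hp0 t y) 3)
            have hy1 : |y| ≤ R / 2 := abs_le.2 ⟨by linarith [hy.1], by linarith [hy.2]⟩
            have hy2 : 3 / 4 * R ^ 2 ≤ R ^ 2 - y ^ 2 := by
              nlinarith [sq_abs y, abs_nonneg y]
            calc (27 / 64) * R ^ 6 = (3 / 4 * R ^ 2) ^ 3 := by ring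
              _ ≤ _ := pow_le_pow_left₀ (by positivity) hy2 3
        _ ≤ _ := by
            refine intervalIntegral.integral_mono_interval (by linarith) (by linarith)
              (by linarith) ?_ (Continuous.intervalIntegrable (by fun_prop) _ _)
            refine (ae_restrict_iff' measurableSet_Ioc).2 (Eventually.of_forall fun y hy => ?_)
            exact mul_nonneg (pow_nonneg (hweight R y ⟨hy.1.le, hy.2⟩) 3) (pow_nonneg (hp0 t y) 3)
    have h2 := lower.trans (energy R hR0)
    have h3 : R ^ 5 * ((27 / 64) * R * I) ≤ R ^ 5 * C := by
      rw [hC]; linarith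
    exact le_of_mul_le_mul_left h3 (by positivity)
  have h1 := hmain (max (2 * (|x| + 1)) (64 / 27 * (C + 1) / I)) (le_max_left _ _)
  have h2 : 64 / 27 * (C + 1) / I * I = 64 / 27 * (C + 1) := by field_simp
  have h3 := mul_le_mul_of_nonneg_right
    (le_max_right (2 * (|x| + 1)) (64 / 27 * (C + 1) / I)) hIpos.le
  linarith

/-- `u` takes the locally integrable value `v` at time `t₀` from the right in `L¹_loc`. -/
def AttainsData (t₀ : ℝ) (u : ℝ → ℝ → ℝ) (v : ℝ → ℝ) : Prop :=
  LocallyIntegrable v ∧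
    ∀ R > 0, Tendsto (fun t => ∫ x in (-R)..R, |u t x - v x|) (𝓝[>] t₀) (𝓝 0)

/-- A classical function takes its own values at times at which it is regular. -/
lemma ClassicalAfter.attainsData {t₀ t₁ : ℝ} {u ut ux uxx : ℝ → ℝ → ℝ}
    (h : ClassicalAfter t₀ u ut ux uxx) (h01 : t₀ < t₁) : AttainsData t₁ u (u t₁) := by
  refine ⟨(h.cont_slice h01).locallyIntegrable, fun R _ => ?_⟩
  -- freezing `u` before time `t₁` makes it continuous on the whole plane
  have hc : Continuous fun z : ℝ × ℝ => u (max z.1 t₁) z.2 :=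
    h.cont.comp_continuous (f := fun z : ℝ × ℝ => (max z.1 t₁, z.2)) (by fun_prop)
      fun z => ⟨h01.trans_le (le_max_right _ _), Set.mem_univ _⟩
  have hs := h.cont_slice h01
  have hint : Continuous fun t => ∫ x in (-R)..R, |u (max t t₁) x - u t₁ x| := by
    refine intervalIntegral.continuous_parametric_intervalIntegral_of_continuous'
      (f := fun t x => |u (max t t₁) x - u t₁ x|) ?_ _ _
    exact (hc.sub (hs.comp continuous_snd)).abs
  have hlim := (hint.tendsto t₁).mono_left (nhdsWithin_le_nhds (s := Set.Ioi t₁))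
  simp only [max_self, sub_self, abs_zero, intervalIntegral.integral_zero] at hlim
  refine hlim.congr' ?_
  filter_upwards [self_mem_nhdsWithin] with t ht
  rw [max_eq_left (le_of_lt ht)]

lemma AttainsData.neg {t₀ : ℝ} {u : ℝ → ℝ → ℝ} {v : ℝ → ℝ} (h : AttainsData t₀ u v) :
    AttainsData t₀ (fun t x => -u t x) (fun x => -v x) := by
  refine ⟨h.1.neg, fun R hR => ?_⟩
  have e : ∀ t x, |-u t x - -v x| = |u t x - v x| := fun t x => by
    rw [← abs_neg]; congr 1; ring
  simpa only [e] using h.2 R hR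

/-- If a continuous `ψ` starts below the data of `u`, then `(ψ - u)⁺` vanishes initially. -/
lemma AttainsData.tendsto_posPart {t₀ : ℝ} {u ψ : ℝ → ℝ → ℝ} {v : ℝ → ℝ}
    (h : AttainsData t₀ u v) (hu : ∀ t > t₀, Continuous (u t))
    (hψ : Continuous fun z : ℝ × ℝ => ψ z.1 z.2) (hle : ∀ x, ψ t₀ x ≤ v x) {R : ℝ} (hR : 0 < R) :
    Tendsto (fun t => ∫ x in (-R)..R, max (ψ t x - u t x) 0) (𝓝[>] t₀) (𝓝 0) := by
  have hslice : ∀ t, Continuous (ψ t) := fun t => hψ.comp (f := fun x => (t, x)) (by fun_prop)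
  have hs0 := hslice t₀
  have hint : Continuous fun t => ∫ x in (-R)..R, |ψ t x - ψ t₀ x| := by
    refine intervalIntegral.continuous_parametric_intervalIntegral_of_continuous'
      (f := fun t x => |ψ t x - ψ t₀ x|) ?_ _ _
    exact (hψ.sub (hs0.comp continuous_snd)).abs
  have hlim := (hint.tendsto t₀).mono_left (nhdsWithin_le_nhds (s := Set.Ioi t₀))
  simp only [sub_self, abs_zero, intervalIntegral.integral_zero] at hlim
  have hsum := hlim.add (h.2 R hR)
  rw [add_zero] at hsum
  refine squeeze_zero' (Eventually.of_forall fun t => ?_) ?_ hsum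
  · exact intervalIntegral.integral_nonneg (by linarith) fun x _ => le_max_right _ _
  · filter_upwards [self_mem_nhdsWithin] with t ht
    have c1 := hslice t
    have c2 := hu t ht
    have i1 : IntervalIntegrable (fun x => |ψ t x - ψ t₀ x|) volume (-R) R :=
      Continuous.intervalIntegrable (by fun_prop) _ _
    have hv : IntervalIntegrable v volume (-R) R :=
      (h.1.integrableOn_isCompact isCompact_uIcc).intervalIntegrable
    have i2 : IntervalIntegrable (fun x => |u t x - v x|) volume (-R) R :=
      ((c2.intervalIntegrable _ _).sub hv).abs
    rw [← intervalIntegral.integral_add i1 i2]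
    refine intervalIntegral.integral_mono_on (by linarith)
      (Continuous.intervalIntegrable (by fun_prop) _ _) (i1.add i2) fun x _ => ?_
    refine max_le ?_ (add_nonneg (abs_nonneg _) (abs_nonneg _))
    have h1 := le_abs_self (ψ t x - ψ t₀ x)
    have h2 := neg_abs_le (u t x - v x)
    linarith [hle x]

/-! ### Compactly supported moving subsolutions -/

/-- The exponentially weighted bump `e^{-ay} ((1 - (y/L)²)⁺)³`, of class `C²` and supported in
`[-L, L]`. -/
noncomputable def bump (a L y : ℝ) : ℝ :=
  Real.exp (-(a * y)) * (max (1 - (y / L) ^ 2) 0) ^ 3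

/-- The derivative of `bump`. -/
noncomputable def bumpDeriv (a L y : ℝ) : ℝ :=
  Real.exp (-(a * y)) * (-a * (max (1 - (y / L) ^ 2) 0) ^ 3
    - 6 * y / L ^ 2 * (max (1 - (y / L) ^ 2) 0) ^ 2)

/-- The second derivative of `bump`. -/
noncomputable def bumpDerivTwo (a L y : ℝ) : ℝ :=
  Real.exp (-(a * y)) * (a ^ 2 * (max (1 - (y / L) ^ 2) 0) ^ 3
    + 12 * a * y / L ^ 2 * (max (1 - (y / L) ^ 2) 0) ^ 2
    - 6 / L ^ 2 * (max (1 - (y / L) ^ 2) 0) ^ 2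
    + 24 * y ^ 2 / L ^ 4 * max (1 - (y / L) ^ 2) 0)

lemma continuous_bump (a L : ℝ) : Continuous (bump a L) := by
  unfold bump; fun_prop

lemma continuous_bumpDeriv (a L : ℝ) : Continuous (bumpDeriv a L) := by
  unfold bumpDeriv; fun_prop

lemma continuous_bumpDerivTwo (a L : ℝ) : Continuous (bumpDerivTwo a L) := by
  unfold bumpDerivTwo; fun_prop

lemma bump_nonneg (a L y : ℝ) : 0 ≤ bump a L y :=
  mul_nonneg (Real.exp_pos _).le (pow_nonneg (le_max_right _ _) 3)

lemma bump_eq_zero {a L y : ℝ} (hL : 0 < L) (hy : L ≤ |y|) : bump a L y = 0 := by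
  have : 1 ≤ (y / L) ^ 2 := by
    rw [div_pow, one_le_div (by positivity), ← sq_abs y]
    exact pow_le_pow_left₀ hL.le hy 2
  unfold bump
  rw [max_eq_right (by linarith)]; simp

lemma abs_lt_of_bump_pos {a L y : ℝ} (hL : 0 < L) (hy : 0 < bump a L y) : |y| < L := by
  by_contra! h
  exact hy.ne' (bump_eq_zero hL h)

lemma bump_le_exp {a L y : ℝ} (hL : 0 < L) : bump a L y ≤ Real.exp (|a| * L) := by
  rcases le_or_gt L |y| with hy | hy
  · rw [bump_eq_zero hL hy]; exact (Real.exp_pos _).le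
  · have h1 : (max (1 - (y / L) ^ 2) 0) ^ 3 ≤ 1 :=
      pow_le_one₀ (le_max_right _ _) (max_le (by nlinarith [sq_nonneg (y / L)]) zero_le_one)
    have h2 : -(a * y) ≤ |a| * L := by
      calc -(a * y) ≤ |a * y| := neg_le_abs _
        _ = |a| * |y| := abs_mul _ _
        _ ≤ _ := mul_le_mul_of_nonneg_left hy.le (abs_nonneg _)
    calc bump a L y ≤ Real.exp (-(a * y)) * 1 :=
          mul_le_mul_of_nonneg_left h1 (Real.exp_pos _).le
      _ ≤ _ := by rw [mul_one]; exact Real.exp_le_exp.2 h2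

/-- Lower bound for the bump on the inner half of its support; `27/64 = (3/4)³`. -/
lemma exp_le_bump {a L y : ℝ} (hL : 0 < L) (hy : |y| ≤ L / 2) :
    27 / 64 * Real.exp (-(|a| * L)) ≤ bump a L y := by
  have h0 : (y / L) ^ 2 ≤ 1 / 4 := by
    rw [div_pow, div_le_iff₀ (by positivity), ← sq_abs y]
    nlinarith [abs_nonneg y]
  have h1 : (27 / 64 : ℝ) ≤ (max (1 - (y / L) ^ 2) 0) ^ 3 := by
    calc (27 / 64 : ℝ) = (3 / 4) ^ 3 := by norm_num
      _ ≤ _ := pow_le_pow_left₀ (by norm_num) (le_max_of_le_left (by linarith)) 3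
  have h2 : -(|a| * L) ≤ -(a * y) := by
    have : a * y ≤ |a| * L := by
      calc a * y ≤ |a * y| := le_abs_self _
        _ = |a| * |y| := abs_mul _ _
        _ ≤ _ := mul_le_mul_of_nonneg_left (by linarith) (abs_nonneg _)
    linarith
  calc 27 / 64 * Real.exp (-(|a| * L)) = Real.exp (-(|a| * L)) * (27 / 64) := mul_comm _ _
    _ ≤ _ := mul_le_mul (Real.exp_le_exp.2 h2) h1 (by norm_num) (Real.exp_pos _).le

lemma hasDerivAt_bump (a L y : ℝ) : HasDerivAt (bump a L) (bumpDeriv a L y) y := by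
  have e0 : HasDerivAt (fun y : ℝ => 1 - (y / L) ^ 2) (-(2 * (y / L) * (1 / L))) y := by
    simpa using (((hasDerivAt_id y).div_const L).pow 2).const_sub 1
  have e1 := (hasDerivAt_posPart_cube (1 - (y / L) ^ 2)).comp y e0
  have e2 := (((hasDerivAt_id y).const_mul a).neg.exp).mul e1
  refine HasDerivAt.congr_deriv (f := _) e2 ?_
  simp only [bumpDeriv, Pi.neg_apply, Function.comp_apply, id]
  ring

lemma hasDerivAt_bumpDeriv (a L y : ℝ) :
    HasDerivAt (bumpDeriv a L) (bumpDerivTwo a L y) y := by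
  have e0 : HasDerivAt (fun y : ℝ => 1 - (y / L) ^ 2) (-(2 * (y / L) * (1 / L))) y := by
    simpa using (((hasDerivAt_id y).div_const L).pow 2).const_sub 1
  have e1 := (hasDerivAt_posPart_cube (1 - (y / L) ^ 2)).comp y e0
  have e2 := (hasDerivAt_posPart_sq (1 - (y / L) ^ 2)).comp y e0
  have e3 := (((hasDerivAt_id y).const_mul a).neg.exp).mul ((e1.const_mul (-a)).sub
    ((((hasDerivAt_id y).const_mul 6).div_const (L ^ 2)).mul e2))
  refine HasDerivAt.congr_deriv (f := _) e3 ?_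
  simp only [bumpDerivTwo, Pi.neg_apply, Pi.mul_apply, Pi.sub_apply, Function.comp_apply, id]
  ring

/-- The weight `a = c / (2D)` removes the drift, and the bump then costs only `10 D / L²` of the
growth rate. -/
lemma bump_diffusion_drift_ge {D c L : ℝ} (hD : 0 < D) (hL : 0 < L) (y : ℝ) :
    -((c ^ 2 / (4 * D) + 10 * D / L ^ 2) * bump (c / (2 * D)) L y) ≤
      D * bumpDerivTwo (c / (2 * D)) L y + c * bumpDeriv (c / (2 * D)) L y := by
  unfold bump bumpDeriv bumpDerivTwo
  set q := max (1 - (y / L) ^ 2) 0 with hq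
  set e := Real.exp (-(c / (2 * D) * y)) with he
  have he0 : 0 < e := Real.exp_pos _
  have key : D * (e * ((c / (2 * D)) ^ 2 * q ^ 3 + 12 * (c / (2 * D)) * y / L ^ 2 * q ^ 2
      - 6 / L ^ 2 * q ^ 2 + 24 * y ^ 2 / L ^ 4 * q))
      + c * (e * (-(c / (2 * D)) * q ^ 3 - 6 * y / L ^ 2 * q ^ 2))
      + (c ^ 2 / (4 * D) + 10 * D / L ^ 2) * (e * q ^ 3)
      = e * (D / L ^ 2) * (q * (10 * q ^ 2 - 6 * q + 24 * (y / L) ^ 2)) := by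
    field_simp
    ring
  have hpos : 0 ≤ q * (10 * q ^ 2 - 6 * q + 24 * (y / L) ^ 2) := by
    rcases le_or_gt (1 - (y / L) ^ 2) 0 with h | h
    · rw [hq, max_eq_right h]; simp
    · have hq' : q = 1 - (y / L) ^ 2 := by rw [hq, max_eq_left h.le]
      have hy : (y / L) ^ 2 = 1 - q := by linarith
      rw [hy]
      refine mul_nonneg (by linarith) ?_
      nlinarith [sq_nonneg (q - 3 / 2)]
  have : 0 ≤ e * (D / L ^ 2) * (q * (10 * q ^ 2 - 6 * q + 24 * (y / L) ^ 2)) := by positivity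
  linarith

lemma classicalAfter_bump {m m' : ℝ → ℝ} (hm : ∀ t, HasDerivAt m (m' t) t)
    (hm' : Continuous m') (t₀ a L X c : ℝ) :
    ClassicalAfter t₀ (fun t x => m t * bump a L (x - X - c * t))
      (fun t x => m' t * bump a L (x - X - c * t) - c * m t * bumpDeriv a L (x - X - c * t))
      (fun t x => m t * bumpDeriv a L (x - X - c * t))
      (fun t x => m t * bumpDerivTwo a L (x - X - c * t)) := by
  have hmc : Continuous m := continuous_iff_continuousAt.2 fun t => (hm t).continuousAt
  have b0 := continuous_bump a L
  have b1 := continuous_bumpDeriv a L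
  have b2 := continuous_bumpDerivTwo a L
  have hx : ∀ t x : ℝ, HasDerivAt (fun x : ℝ => x - X - c * t) 1 x := fun t x =>
    ((hasDerivAt_id x).sub_const X).sub_const (c * t)
  refine ⟨fun t _ x => ?_, fun t _ x => ?_, fun t _ x => ?_, ?_, ?_, ?_⟩
  · have e0 : HasDerivAt (fun t : ℝ => x - X - c * t) (-c) t := by
      simpa using ((hasDerivAt_id t).const_mul c).const_sub (x - X)
    have e := (hm t).mul ((hasDerivAt_bump a L (x - X - c * t)).comp t e0)
    refine HasDerivAt.congr_deriv (f := _) e ?_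
    simp only [Function.comp_apply]
    ring
  · have e := ((hasDerivAt_bump a L (x - X - c * t)).comp x (hx t x)).const_mul (m t)
    rw [mul_one] at e
    exact e
  · have e := ((hasDerivAt_bumpDeriv a L (x - X - c * t)).comp x (hx t x)).const_mul (m t)
    rw [mul_one] at e
    exact e
  · exact Continuous.continuousOn (by fun_prop)
  · exact Continuous.continuousOn (by fun_prop)
  · intro t _; fun_prop

/-- A moving bump `m(t) e^{-ay} g(y/L)`, `y = x - X - ct`, stays below a nonnegative `u` as soon as
it starts below it and the differential inequality holds where the bump exceeds `u`. -/
theorem bump_le_of_supersolution {t₀ T D c L X K : ℝ} (hD : 0 < D) (hL : 0 < L) (hK : 0 ≤ K)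
    {m m' : ℝ → ℝ} (hm : ∀ t, HasDerivAt m (m' t) t) (hm' : Continuous m') (hm0 : ∀ t, 0 ≤ m t)
    {u ut ux uxx : ℝ → ℝ → ℝ} (hu : ClassicalAfter t₀ u ut ux uxx)
    (hu0 : ∀ t > t₀, ∀ x, 0 ≤ u t x) {v : ℝ → ℝ} (hv : AttainsData t₀ u v)
    (hv0 : ∀ x, 0 ≤ v x)
    (hle : ∀ x, |x - X - c * t₀| < L → m t₀ * bump (c / (2 * D)) L (x - X - c * t₀) ≤ v x)
    (hpde : ∀ t, t₀ < t → t ≤ T → ∀ x, |x - X - c * t| < L →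
      u t x < m t * bump (c / (2 * D)) L (x - X - c * t) →
      (m' t + (c ^ 2 / (4 * D) + 10 * D / L ^ 2) * m t) * bump (c / (2 * D)) L (x - X - c * t)
        - K * (m t * bump (c / (2 * D)) L (x - X - c * t) - u t x) ≤ ut t x - D * uxx t x)
    {t : ℝ} (ht : t₀ < t) (htT : t ≤ T) (x : ℝ) :
    m t * bump (c / (2 * D)) L (x - X - c * t) ≤ u t x := by
  set a := c / (2 * D) with ha
  have hψ := classicalAfter_bump hm hm' t₀ a L X c
  have hmc : Continuous m := continuous_iff_continuousAt.2 fun t => (hm t).continuousAt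
  obtain ⟨B, hB⟩ := (isCompact_Icc (a := t₀) (b := T)).exists_bound_of_continuousOn
    hmc.continuousOn
  have hw := hψ.sub hu
  have hψc : Continuous fun z : ℝ × ℝ => m z.1 * bump a L (z.2 - X - c * z.1) := by
    have b0 := continuous_bump a L
    fun_prop
  refine sub_nonpos.1 (nonpos_of_subsolution (T := T) (M := B * Real.exp (|a| * L)) hD.le hK hw
    ?_ ?_ (fun R hR => ?_) ht htT x)
  · intro s hs hsT y
    have h1 := hu0 s hs y
    have h2 : m s ≤ B := (le_abs_self _).trans (hB s ⟨hs.le, hsT⟩)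
    have h3 : m s * bump a L (y - X - c * s) ≤ B * Real.exp (|a| * L) :=
      mul_le_mul h2 (bump_le_exp hL) (bump_nonneg _ _ _) ((hm0 s).trans h2)
    linarith
  · intro s hs hsT y hpos
    have hlt : u s y < m s * bump a L (y - X - c * s) := by linarith
    have hb : |y - X - c * s| < L := by
      refine abs_lt_of_bump_pos (a := a) hL (lt_of_le_of_ne (bump_nonneg _ _ _) fun h0 => ?_)
      rw [← h0, mul_zero] at hlt
      exact absurd (hu0 s hs y) (not_le.2 hlt)
    have h1 := hpde s hs hsT y hb hlt
    have h2 := mul_le_mul_of_nonneg_left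
      (bump_diffusion_drift_ge (D := D) (c := c) (L := L) hD hL (y - X - c * s)) (hm0 s)
    rw [← ha] at h2
    nlinarith
  · refine hv.tendsto_posPart (ψ := fun t x => m t * bump a L (x - X - c * t))
      (fun t ht => hu.cont_slice ht) hψc (fun y => ?_) hR
    rcases lt_or_ge (|y - X - c * t₀|) L with h | h
    · exact hle y h
    · simp only [bump_eq_zero hL h, mul_zero]; exact hv0 y

/-- Comparison of `u` with a globally continuous barrier `ψ` lying above the data of `u`. -/
theorem le_barrier {t₀ T D K M : ℝ} (hD : 0 ≤ D) (hK : 0 ≤ K)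
    {u ut ux uxx ψ ψt ψx ψxx : ℝ → ℝ → ℝ} (hu : ClassicalAfter t₀ u ut ux uxx)
    (hψ : ClassicalAfter t₀ ψ ψt ψx ψxx) (hψc : Continuous fun z : ℝ × ℝ => ψ z.1 z.2)
    {v : ℝ → ℝ} (hv : AttainsData t₀ u v) (hle : ∀ x, v x ≤ ψ t₀ x)
    (hM : ∀ t, t₀ < t → t ≤ T → ∀ x, u t x - ψ t x ≤ M)
    (hpde : ∀ t, t₀ < t → t ≤ T → ∀ x, ψ t x < u t x →
      ut t x - ψt t x ≤ D * (uxx t x - ψxx t x) + K * (u t x - ψ t x))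
    {t : ℝ} (ht : t₀ < t) (htT : t ≤ T) (x : ℝ) : u t x ≤ ψ t x := by
  refine sub_nonpos.1 (nonpos_of_subsolution hD hK (hu.sub hψ) hM
    (fun s hs hsT y hy => hpde s hs hsT y (by linarith)) (fun R hR => ?_) ht htT x)
  have h := hv.neg.tendsto_posPart (ψ := fun t x => -ψ t x) (fun t ht => (hu.cont_slice ht).neg)
    hψc.neg (fun x => neg_le_neg (hle x)) hR
  refine h.congr fun s => intervalIntegral.integral_congr fun y _ => ?_
  have e : -ψ s y - -u s y = u s y - ψ s y := by ring
  exact congrArg (fun z => max z 0) e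

lemma classicalAfter_zero (t₀ : ℝ) :
    ClassicalAfter t₀ (fun _ _ => 0) (fun _ _ => 0) (fun _ _ => 0) (fun _ _ => 0) where
  time _ _ _ := hasDerivAt_const _ _
  space _ _ _ := hasDerivAt_const _ _
  space_two _ _ _ := hasDerivAt_const _ _
  cont := continuousOn_const
  cont_time := continuousOn_const
  cont_space_two _ _ := continuous_const

lemma classicalAfter_exp (t₀ a b ν σ : ℝ) :
    ClassicalAfter t₀ (fun t x => (a + b * t) * Real.exp (-(ν * x) + σ * t))
      (fun t x => (b + σ * (a + b * t)) * Real.exp (-(ν * x) + σ * t))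
      (fun t x => -ν * (a + b * t) * Real.exp (-(ν * x) + σ * t))
      (fun t x => ν ^ 2 * (a + b * t) * Real.exp (-(ν * x) + σ * t)) := by
  have hx : ∀ t x : ℝ, HasDerivAt (fun x => Real.exp (-(ν * x) + σ * t))
      (Real.exp (-(ν * x) + σ * t) * (-ν)) x := fun t x => by
    have := (((hasDerivAt_id x).const_mul ν).neg.add_const (σ * t)).exp
    simpa using this
  refine ⟨fun t _ x => ?_, fun t _ x => ?_, fun t _ x => ?_, ?_, ?_, ?_⟩
  · have e1 : HasDerivAt (fun t : ℝ => a + b * t) b t := by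
      simpa using ((hasDerivAt_id t).const_mul b).const_add a
    have e2 : HasDerivAt (fun t : ℝ => -(ν * x) + σ * t) σ t := by
      simpa using ((hasDerivAt_id t).const_mul σ).const_add (-(ν * x))
    exact (e1.mul e2.exp).congr_deriv (by ring)
  · exact ((hx t x).const_mul _).congr_deriv (by ring)
  · exact ((hx t x).const_mul _).congr_deriv (by ring)
  · exact Continuous.continuousOn (by fun_prop)
  · exact Continuous.continuousOn (by fun_prop)
  · intro t _; fun_prop

namespace ClassicalAfter

lemma const_mul {t₀ : ℝ} {w wt wx wxx : ℝ → ℝ → ℝ} (h : ClassicalAfter t₀ w wt wx wxx) (k : ℝ) :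
    ClassicalAfter t₀ (fun t x => k * w t x) (fun t x => k * wt t x)
      (fun t x => k * wx t x) (fun t x => k * wxx t x) where
  time t ht x := (h.time t ht x).const_mul k
  space t ht x := (h.space t ht x).const_mul k
  space_two t ht x := (h.space_two t ht x).const_mul k
  cont := continuousOn_const.mul h.cont
  cont_time := continuousOn_const.mul h.cont_time
  cont_space_two t ht := continuous_const.mul (h.cont_space_two t ht)

end ClassicalAfter

/-! ### The reflected system and its exponential upper bounds -/

lemma IsC12.classicalAfter {u : ℝ → ℝ → ℝ} (h : IsC12 u) :
    ClassicalAfter 0 u (fun t x => deriv (fun s => u s x) t) (fun t => deriv (u t))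
      (fun t => deriv (deriv (u t))) where
  time t ht x := (h.diff_time t ht x).hasDerivAt
  space t ht x := (h.diff_space t ht x).hasDerivAt
  space_two t ht x := (h.diff_space_two t ht x).hasDerivAt
  cont := h.cont
  cont_time := h.cont_time
  cont_space_two _ ht := 
    continuous_slice (f := fun t => deriv (deriv (u t))) h.cont_space_two ht

/-- The features of perturbed steps that the argument uses. -/
lemma IsPerturbedStep.bounds {f : ℝ → ℝ} (hf : IsPerturbedStep f) :
    LocallyIntegrable f ∧ ∃ h R M : ℝ, 0 < h ∧ 0 < R ∧ 0 < M ∧ (∀ x, f x ≤ M) ∧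
      (∀ x < -R, f x = h) ∧ ∀ x > R, f x = 0 := by
  obtain ⟨-, h, hh, p, hpm, ⟨M, hM⟩, hpc, hfp⟩ := hf
  obtain ⟨R, hR, hpR⟩ := hpc.exists_pos_le_norm
  have hM0 : 0 ≤ M := (abs_nonneg _).trans (hM 0)
  have hle : ∀ x, |f x| ≤ h + M := fun x => by
    rw [hfp x]
    refine (abs_add_le _ _).trans (add_le_add ?_ (hM x))
    split_ifs
    · rw [abs_of_pos hh]
    · rw [abs_zero]; exact hh.le
  have hmeas : Measurable f := by
    have : f = fun x => (if x < 0 then h else 0) + p x := funext hfp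
    rw [this]
    exact (Measurable.ite measurableSet_Iio measurable_const measurable_const).add hpm
  refine ⟨?_, h, R, h + M, hh, hR, by linarith, fun x => (le_abs_self _).trans (hle x), ?_, ?_⟩
  · have hc : LocallyIntegrable (fun _ : ℝ => h + M) := continuous_const.locallyIntegrable
    exact hc.mono hmeas.aestronglyMeasurable (Eventually.of_forall fun x => by
      rw [Real.norm_eq_abs, Real.norm_eq_abs]; exact (hle x).trans (le_abs_self _))
  · intro x hx
    rw [hfp x, if_pos (by linarith), hpR x (by
      rw [Real.norm_eq_abs, abs_of_neg (by linarith)]; linarith), add_zero]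
  · intro x hx
    rw [hfp x, if_neg (by linarith), hpR x (by
      rw [Real.norm_eq_abs, abs_of_pos (by linarith)]; linarith), add_zero]

/-- A bounded function vanishing on the far right lies below every decaying exponential of
sufficiently large amplitude. -/
lemma IsPerturbedStep.exists_le_exp {f : ℝ → ℝ} (hf : IsPerturbedStep f) {ν : ℝ}
    (hν : 0 < ν) : ∃ C > 0, ∀ x, f x ≤ C * Real.exp (-(ν * x)) := by
  obtain ⟨-, h, R, M, -, -, hM0, hM, -, hR⟩ := hf.bounds
  refine ⟨M * Real.exp (ν * R), by positivity, fun x => ?_⟩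
  rcases le_or_gt x R with hx | hx
  · refine (hM x).trans ?_
    rw [mul_assoc, ← Real.exp_add]
    refine le_mul_of_one_le_right hM0.le (Real.one_le_exp ?_)
    nlinarith
  · rw [hR x hx]; positivity

lemma HasInitialValue.attainsData {u : ℝ → ℝ → ℝ} {v : ℝ → ℝ} (h : HasInitialValue u v)
    (hv : LocallyIntegrable v) : AttainsData 0 u v := by
  refine ⟨hv, fun R hR => (h R).congr fun t => ?_⟩
  rw [intervalIntegral.integral_of_le (by linarith), integral_Icc_eq_integral_Ioc]

/-- A bounded classical solution of the system with coupling `g > 0`, in which `V = sgn(γ) U` and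
`g = |γ|`, with nonnegative perturbed steps as data. -/
structure ReflectedSolution (d α g : ℝ) (V Vt Vx Vxx A At Ax Axx : ℝ → ℝ → ℝ)
    (V0 A0 : ℝ → ℝ) : Prop where
  d_pos : 0 < d
  α_pos : 0 < α
  g_pos : 0 < g
  V_cl : ClassicalAfter 0 V Vt Vx Vxx
  A_cl : ClassicalAfter 0 A At Ax Axx
  V_bdd : BoundedOnStrips V
  A_bdd : BoundedOnStrips A
  V_data : AttainsData 0 V V0
  A_data : AttainsData 0 A A0
  V_step : IsPerturbedStep V0
  A_step : IsPerturbedStep A0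
  V_eq : ∀ t > 0, ∀ x, Vt t x =
    d * Vxx t x + (α - 6 * A t x ^ 2) * V t x - V t x ^ 3 + 2 * g * A t x ^ 2
  A_eq : ∀ t > 0, ∀ x, At t x = 4 * Axx t x + A t x - 3 * A t x ^ 3

/-- Reflecting `U` by the sign of `γ` reduces the system to a positive coupling. -/
lemma IsSolution.reflected {d α γ : ℝ} {U A : ℝ → ℝ → ℝ} {U0 A0 : ℝ → ℝ} (hd : 0 < d)
    (hα : 0 < α) (hγ : γ ≠ 0) (h : IsSolution d α γ U A U0 A0)
    (hU0 : IsPerturbedStep fun x => Real.sign γ * U0 x) (hA0 : IsPerturbedStep A0) :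
    ReflectedSolution d α |γ| (fun t x => Real.sign γ * U t x)
      (fun t x => Real.sign γ * deriv (fun s => U s x) t)
      (fun t x => Real.sign γ * deriv (U t) x)
      (fun t x => Real.sign γ * deriv (deriv (U t)) x) A
      (fun t x => deriv (fun s => A s x) t) (fun t => deriv (A t))
      (fun t => deriv (deriv (A t))) (fun x => Real.sign γ * U0 x) A0 := by
  have hs : Real.sign γ * γ = |γ| ∧ Real.sign γ ^ 2 = 1 ∧ |Real.sign γ| = 1 := by
    rcases lt_or_gt_of_ne hγ with hneg | hpos
    · rw [Real.sign_of_neg hneg, abs_of_neg hneg]; norm_num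
    · rw [Real.sign_of_pos hpos, abs_of_pos hpos]; norm_num
  obtain ⟨hs1, hs2, hs3⟩ := hs
  refine ⟨hd, hα, abs_pos.2 hγ, h.regU.classicalAfter.const_mul _, h.regA.classicalAfter, ?_,
    h.bddA, ?_, h.initA.attainsData hA0.bounds.1, hU0, hA0, ?_, h.eqA⟩
  · intro T
    obtain ⟨M, hM⟩ := h.bddU T
    exact ⟨M, fun t ht htT x => by rw [abs_mul, hs3, one_mul]; exact hM t ht htT x⟩
  · refine HasInitialValue.attainsData (fun R => ?_) hU0.bounds.1
    refine (h.initU R).congr fun t => ?_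
    simp only [← mul_sub, abs_mul, hs3, one_mul]
  · intro t ht x
    rw [h.eqU t ht x, ← hs1]
    linear_combination (-(Real.sign γ * U t x ^ 3)) * (-hs2)

namespace ReflectedSolution

variable {d α g : ℝ} {V Vt Vx Vxx A At Ax Axx : ℝ → ℝ → ℝ} {V0 A0 : ℝ → ℝ}

lemma A_nonneg (h : ReflectedSolution d α g V Vt Vx Vxx A At Ax Axx V0 A0) :
    ∀ t > 0, ∀ x, 0 ≤ A t x := by
  intro t ht x
  obtain ⟨M, hM⟩ := h.A_bdd t
  refine neg_nonpos.1 (le_barrier (t₀ := 0) (T := t) (D := 4) (K := 1) (M := M) (by norm_num)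
    (by norm_num) h.A_cl.neg (classicalAfter_zero 0) continuous_const h.A_data.neg
    (fun x => neg_nonpos.2 (h.A_step.1 x)) (fun s hs hst y => ?_) (fun s hs hst y hy => ?_)
    ht le_rfl x)
  · have := neg_abs_le (A s y)
    linarith [hM s hs hst y]
  · have hy' : 0 < -A s y := hy
    have := pow_pos hy' 3
    rw [h.A_eq s hs y]
    nlinarith

lemma V_nonneg (h : ReflectedSolution d α g V Vt Vx Vxx A At Ax Axx V0 A0) :
    ∀ t > 0, ∀ x, 0 ≤ V t x := by
  intro t ht x
  obtain ⟨M, hM⟩ := h.V_bdd t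
  refine neg_nonpos.1 (le_barrier (t₀ := 0) (T := t) (D := d) (K := α) (M := M) h.d_pos.le
    h.α_pos.le h.V_cl.neg (classicalAfter_zero 0) continuous_const h.V_data.neg
    (fun x => neg_nonpos.2 (h.V_step.1 x)) (fun s hs hst y => ?_) (fun s hs hst y hy => ?_)
    ht le_rfl x)
  · have := neg_abs_le (V s y)
    linarith [hM s hs hst y]
  · have hy' : 0 < -V s y := hy
    have h1 := pow_pos hy' 3
    have h2 := mul_nonneg (sq_nonneg (A s y)) hy'.le
    have h3 := mul_nonneg h.g_pos.le (sq_nonneg (A s y))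
    rw [h.V_eq s hs y]
    nlinarith

/-- The linearised equation for `A` propagates `e^{-νx}` at the rate `4ν² + 1`. -/
lemma exists_A_le (h : ReflectedSolution d α g V Vt Vx Vxx A At Ax Axx V0 A0) {ν : ℝ}
    (hν : 0 < ν) : ∃ C > 0, ∀ t > 0, ∀ x,
      A t x ≤ C * Real.exp (-(ν * x) + (4 * ν ^ 2 + 1) * t) := by
  obtain ⟨C, hC, hCf⟩ := h.A_step.exists_le_exp hν
  refine ⟨C, hC, fun t ht x => ?_⟩
  obtain ⟨M, hM⟩ := h.A_bdd t
  have key := le_barrier (t₀ := 0) (T := t) (D := 4) (K := 1) (M := M) (by norm_num)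
    (by norm_num) h.A_cl (classicalAfter_exp 0 C 0 ν (4 * ν ^ 2 + 1)) (by fun_prop) h.A_data
    (fun x => ?_) (fun s hs hst y => ?_) (fun s hs hst y hy => ?_) ht le_rfl x
  · simpa using key
  · simpa using hCf x
  · have h1 := le_abs_self (A s y)
    have h2 : 0 ≤ (C + 0 * s) * Real.exp (-(ν * y) + (4 * ν ^ 2 + 1) * s) := by
      rw [zero_mul, add_zero]; positivity
    linarith [hM s hs hst y]
  · have h1 := pow_nonneg (h.A_nonneg s hs y) 3
    rw [h.A_eq s hs y]
    nlinarith

/-- At the decay rate `p` at which the linearised `V` equation and the forcing by `A²` are in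
resonance, `V` is bounded by the corresponding exponential up to a factor linear in time. -/
lemma exists_V_le (h : ReflectedSolution d α g V Vt Vx Vxx A At Ax Axx V0 A0) {p : ℝ}
    (hp : 0 < p) (hres : d * p ^ 2 + α = 2 * p ^ 2 + 2) : ∃ C > 0, ∃ B > 0, ∀ t > 0, ∀ x,
      V t x ≤ (C + B * t) * Real.exp (-(p * x) + (d * p ^ 2 + α) * t) := by
  obtain ⟨C, hC, hCf⟩ := h.V_step.exists_le_exp hp
  obtain ⟨C', hC', hA⟩ := h.exists_A_le (ν := p / 2) (by positivity)
  have hg := h.g_pos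
  refine ⟨C, hC, 2 * g * C' ^ 2, by positivity, fun t ht x => ?_⟩
  obtain ⟨M, hM⟩ := h.V_bdd t
  refine le_barrier (t₀ := 0) (T := t) (D := d) (K := α) (M := M) h.d_pos.le
    h.α_pos.le h.V_cl (classicalAfter_exp 0 C (2 * g * C' ^ 2) p (d * p ^ 2 + α)) (by fun_prop)
    h.V_data (fun x => ?_) (fun s hs hst y => ?_) (fun s hs hst y hy => ?_) ht le_rfl x
  · simpa using hCf x
  · have h1 := le_abs_self (V s y)
    have h2 : 0 ≤ (C + 2 * g * C' ^ 2 * s) * Real.exp (-(p * y) + (d * p ^ 2 + α) * s) := by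
      positivity
    linarith [hM s hs hst y]
  · have hV := h.V_nonneg s hs y
    have h1 := pow_nonneg hV 3
    have h2 := mul_nonneg (sq_nonneg (A s y)) hV
    have h3 : A s y ^ 2 ≤ C' ^ 2 * Real.exp (-(p * y) + (d * p ^ 2 + α) * s) := by
      refine (pow_le_pow_left₀ (h.A_nonneg s hs y) (hA s hs y) 2).trans_eq ?_
      rw [mul_pow, ← Real.exp_nat_mul, hres]
      congr 2; push_cast; ring
    have h4 := mul_le_mul_of_nonneg_left h3 (by positivity : 0 ≤ 2 * g)
    rw [h.V_eq s hs y]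
    nlinarith

end ReflectedSolution

/-! ### Lower bounds along the two-speed path -/

/-- The distance `x - 4t` of a path of speeds `4p` and then `c` to the `A` front is affine in each
phase, so it is controlled by its values at the end of the two phases. -/
lemma two_speed_path_ahead {p c r b τ s : ℝ} (hτ : 0 ≤ τ) (hs0 : 0 ≤ s) (hs : s ≤ r * τ)
    (hb1 : b ≤ 4 * p - 4) (hb2 : b ≤ 4 * p + c * r - 4 * (1 + r)) :
    b * τ ≤ (4 * p - 4) * τ + (c - 4) * s := by
  rcases le_or_gt 0 (c - 4) with hc | hc
  · have h1 := mul_nonneg hc hs0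
    have h2 := mul_le_mul_of_nonneg_right hb1 hτ
    linarith
  · have h2 := mul_le_mul_of_nonpos_left hs hc.le
    have h3 := mul_le_mul_of_nonneg_right hb2 hτ
    linarith

namespace ReflectedSolution

variable {d α g : ℝ} {V Vt Vx Vxx A At Ax Axx : ℝ → ℝ → ℝ} {V0 A0 : ℝ → ℝ}

lemma exists_A_sq_le (h : ReflectedSolution d α g V Vt Vx Vxx A At Ax Axx V0 A0) :
    ∃ C > 0, ∀ t > 0, ∀ x, A t x ^ 2 ≤ C * Real.exp (-(x - 4 * t)) := by
  obtain ⟨C, hC, hA⟩ := h.exists_A_le (ν := 1 / 2) (by norm_num)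
  refine ⟨C ^ 2, by positivity, fun t ht x => ?_⟩
  refine (pow_le_pow_left₀ (h.A_nonneg t ht x) (hA t ht x) 2).trans_eq ?_
  rw [mul_pow, ← Real.exp_nat_mul]
  congr 2; push_cast; ring

/-- Along the ray `x = 4pt` with `p > 1`, which runs ahead of the `A` front, `A` decays no faster
than `e^{-(p² - 1)t}`, up to an arbitrarily small loss `η` in the rate. -/
lemma exists_A_ge (h : ReflectedSolution d α g V Vt Vx Vxx A At Ax Axx V0 A0) {p η L : ℝ}
    (hp : 1 < p) (hL : 0 < L) (hLη : 40 / L ^ 2 ≤ η) :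
    ∃ X₀, ∀ X ≤ X₀, ∃ k > 0, ∀ t > 0, ∀ x, |x - X - 4 * p * t| ≤ L / 2 →
      k * Real.exp (-((p ^ 2 - 1 + η) * t)) ≤ A t x := by
  obtain ⟨-, H, R, -, hH, hR, -, -, hleft, -⟩ := h.A_step.bounds
  obtain ⟨C, hC, hA⟩ := h.exists_A_sq_le
  refine ⟨-R - L, fun X hX => ?_⟩
  set β := 4 * p - 4 with hβ
  have hβ0 : 0 < β := by rw [hβ]; linarith
  set C₁ := C * Real.exp (L - X) with hC₁
  have hC₁0 : 0 < C₁ := by positivity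
  set a := 4 * p / (2 * 4) with ha
  set k₀ := H * Real.exp (-(3 * C₁ / β) - |a| * L) with hk₀
  have hk₀0 : 0 < k₀ := by positivity
  -- the factor `exp (3C₁/β e^{-βt})` absorbs the cubic term, which is integrable in time here
  set m : ℝ → ℝ := fun t =>
    k₀ * Real.exp (-((p ^ 2 - 1 + η) * t) + 3 * C₁ / β * Real.exp (-(β * t))) with hm
  have hm0 : ∀ t, 0 ≤ m t := fun t => by positivity
  have hmd : ∀ t, HasDerivAt m
      (m t * (-(p ^ 2 - 1 + η) - 3 * C₁ * Real.exp (-(β * t)))) t := by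
    intro t
    have e1 : HasDerivAt (fun t : ℝ => -(β * t)) (-β) t := by
      exact HasDerivAt.congr_deriv (f := _) ((hasDerivAt_id t).const_mul β).neg (by ring)
    have e2 : HasDerivAt (fun t : ℝ => -((p ^ 2 - 1 + η) * t)) (-(p ^ 2 - 1 + η)) t := by
      exact HasDerivAt.congr_deriv (f := _) ((hasDerivAt_id t).const_mul _).neg (by ring)
    refine HasDerivAt.congr_deriv (f := _)
      ((e2.add (e1.exp.const_mul (3 * C₁ / β))).exp.const_mul k₀) ?_
    simp only [hm, Pi.add_apply]
    field_simp
    ring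
  have hmc : Continuous fun t => m t * (-(p ^ 2 - 1 + η) - 3 * C₁ * Real.exp (-(β * t))) := by
    have : Continuous m := by simp only [hm]; fun_prop
    fun_prop
  refine ⟨k₀ * (27 / 64 * Real.exp (-(|a| * L))), by positivity, fun t ht x hx => ?_⟩
  have key := bump_le_of_supersolution (D := 4) (c := 4 * p) (X := X) (K := 1) (T := t)
    (by norm_num) hL zero_le_one hmd hmc hm0 h.A_cl h.A_nonneg h.A_data h.A_step.1
    (fun y hy => ?_) (fun s hs hst y hy hlt => ?_) ht le_rfl x
  · rw [← ha] at key
    refine le_trans ?_ key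
    have h1 : k₀ * Real.exp (-((p ^ 2 - 1 + η) * t)) ≤ m t := by
      refine mul_le_mul_of_nonneg_left (Real.exp_le_exp.2 ?_) hk₀0.le
      have : 0 ≤ 3 * C₁ / β * Real.exp (-(β * t)) := by positivity
      linarith
    calc _ = k₀ * Real.exp (-((p ^ 2 - 1 + η) * t)) * (27 / 64 * Real.exp (-(|a| * L))) := by ring
      _ ≤ _ := mul_le_mul h1 (exp_le_bump hL hx) (by positivity) (hm0 t)
  · rw [mul_zero, sub_zero] at hy
    have := (abs_lt.1 hy).2
    rw [hleft y (by linarith), ← ha]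
    have hm00 : m 0 = k₀ * Real.exp (3 * C₁ / β) := by simp [hm]
    calc m 0 * bump a L (y - X - 4 * p * 0) ≤ m 0 * Real.exp (|a| * L) :=
          mul_le_mul_of_nonneg_left (bump_le_exp hL) (hm0 0)
      _ = H := by
          rw [hm00, hk₀, mul_assoc, mul_assoc, ← Real.exp_add, ← Real.exp_add]
          have : -(3 * C₁ / β) - |a| * L + (3 * C₁ / β + |a| * L) = 0 := by ring
          rw [this, Real.exp_zero, mul_one]
  · rw [← ha] at hlt ⊢
    set ψ := m s * bump a L (y - X - 4 * p * s) with hψ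
    have hA0 := h.A_nonneg s hs y
    have hψ0 : 0 ≤ ψ := hA0.trans hlt.le
    have hsq : A s y ^ 2 ≤ C₁ * Real.exp (-(β * s)) := by
      refine (hA s hs y).trans ?_
      rw [hC₁, mul_assoc, ← Real.exp_add]
      refine mul_le_mul_of_nonneg_left (Real.exp_le_exp.2 ?_) hC.le
      have := (abs_lt.1 hy).1
      rw [hβ]; linarith
    have he : 0 < C₁ * Real.exp (-(β * s)) := by positivity
    have h1 : (m s * (-(p ^ 2 - 1 + η) - 3 * C₁ * Real.exp (-(β * s))) +
        ((4 * p) ^ 2 / (4 * 4) + 10 * 4 / L ^ 2) * m s) * bump a L (y - X - 4 * p * s)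
        = (1 - (η - 40 / L ^ 2) - 3 * (C₁ * Real.exp (-(β * s)))) * ψ := by
      rw [hψ]; ring
    rw [h1, h.A_eq s hs y]
    have h2 : 0 ≤ (η - 40 / L ^ 2) * ψ := mul_nonneg (by linarith) hψ0
    have h3 := mul_le_mul_of_nonneg_left hlt.le he.le
    have h4 := mul_le_mul_of_nonneg_right hsq hA0
    nlinarith

/-- Along the same ray the source `2gA²` keeps `V` above a multiple of `e^{-2(p² - 1 + η)t}`. -/
lemma exists_V_ge (h : ReflectedSolution d α g V Vt Vx Vxx A At Ax Axx V0 A0) {p η L : ℝ}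
    (hp : 1 < p) (hη : 0 < η) (hL : 0 < L) (hLη : 40 / L ^ 2 ≤ η) :
    ∃ X, ∃ k > 0, ∀ t > 0, ∀ x, |x - X - 4 * p * t| ≤ L / 4 →
      k * Real.exp (-(2 * (p ^ 2 - 1 + η) * t)) ≤ V t x := by
  obtain ⟨-, H, R, -, hH, hR, -, -, hleft, -⟩ := h.V_step.bounds
  obtain ⟨X₀, hX₀⟩ := h.exists_A_ge hp hL hLη
  obtain ⟨C, hC, hA⟩ := h.exists_A_sq_le
  have hd := h.d_pos
  have hg := h.g_pos
  set X := min X₀ (-R - L) with hX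
  obtain ⟨kA, hkA, hAge⟩ := hX₀ X (min_le_left _ _)
  have hXR : X ≤ -R - L := min_le_right _ _
  set μ := p ^ 2 - 1 + η with hμ
  have hμ0 : 0 < μ := by rw [hμ]; nlinarith
  set CA := C * Real.exp (L - X) with hCA
  have hCA0 : 0 < CA := by positivity
  set Q := (4 * p) ^ 2 / (4 * d) + 10 * d / (L / 2) ^ 2 with hQ
  have hQ0 : 0 < Q := by positivity
  set a := 4 * p / (2 * d) with ha
  -- small against the data, against `1` (to absorb `V³`), and against the source `2gA²`
  set k₁ := min (min H 1) (2 * g * kA ^ 2 / (Q + 6 * CA + 1)) with hk₁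
  have hk₁0 : 0 < k₁ := lt_min (lt_min hH one_pos) (by positivity)
  have hk₁H : k₁ ≤ H := (min_le_left _ _).trans (min_le_left _ _)
  have hk₁1 : k₁ ≤ 1 := (min_le_left _ _).trans (min_le_right _ _)
  have hk₁s : (Q + 6 * CA + 1) * k₁ ≤ 2 * g * kA ^ 2 := by
    have := (le_div_iff₀ (by positivity)).1
      (min_le_right (min H 1) (2 * g * kA ^ 2 / (Q + 6 * CA + 1)))
    rw [mul_comm]; exact this
  set k₀ := k₁ * Real.exp (-(|a| * (L / 2))) with hk₀
  have hk₀0 : 0 < k₀ := by positivity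
  have hk₀e : k₀ * Real.exp (|a| * (L / 2)) = k₁ := by
    rw [hk₀, mul_assoc, ← Real.exp_add, neg_add_cancel, Real.exp_zero, mul_one]
  set m : ℝ → ℝ := fun t => k₀ * Real.exp (-(2 * μ * t)) with hm
  have hm0 : ∀ t, 0 ≤ m t := fun t => by positivity
  have hmd : ∀ t, HasDerivAt m (-(2 * μ) * m t) t := by
    intro t
    have e1 : HasDerivAt (fun t : ℝ => -(2 * μ * t)) (-(2 * μ)) t := by
      exact HasDerivAt.congr_deriv (f := _) ((hasDerivAt_id t).const_mul _).neg (by ring)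
    exact HasDerivAt.congr_deriv (f := _) (e1.exp.const_mul k₀) (by simp only [hm]; ring)
  have hmc : Continuous fun t => -(2 * μ) * m t := by simp only [hm]; fun_prop
  have hψle : ∀ t y, m t * bump a (L / 2) y ≤ k₁ * Real.exp (-(2 * μ * t)) := fun t y => by
    calc _ ≤ m t * Real.exp (|a| * (L / 2)) :=
          mul_le_mul_of_nonneg_left (bump_le_exp (by positivity)) (hm0 t)
      _ = k₀ * Real.exp (|a| * (L / 2)) * Real.exp (-(2 * μ * t)) := by simp only [hm]; ring
      _ = _ := by rw [hk₀e]
  refine ⟨X, k₀ * (27 / 64 * Real.exp (-(|a| * (L / 2)))), by positivity, fun t ht x hx => ?_⟩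
  have key := bump_le_of_supersolution (D := d) (c := 4 * p) (X := X) (K := 0) (T := t)
    (L := L / 2) hd (by positivity) le_rfl hmd hmc hm0 h.V_cl h.V_nonneg h.V_data h.V_step.1
    (fun y hy => ?_) (fun s hs hst y hy hlt => ?_) ht le_rfl x
  · rw [← ha] at key
    refine le_trans ?_ key
    calc _ = m t * (27 / 64 * Real.exp (-(|a| * (L / 2)))) := by simp only [hm]; ring
      _ ≤ _ := mul_le_mul_of_nonneg_left (exp_le_bump (by positivity) (by linarith)) (hm0 t)
  · rw [mul_zero, sub_zero] at hy
    have := (abs_lt.1 hy).2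
    rw [hleft y (by linarith), ← ha]
    refine (hψle 0 _).trans ?_
    simpa using hk₁H
  · rw [← ha] at hlt ⊢
    set b := bump a (L / 2) (y - X - 4 * p * s) with hb
    have hψ0 : 0 ≤ m s * b := mul_nonneg (hm0 s) (bump_nonneg _ _ _)
    have hV0 := h.V_nonneg s hs y
    have he1 : Real.exp (-(2 * μ * s)) ≤ 1 := by
      rw [Real.exp_le_one_iff]; have := mul_pos hμ0 hs; linarith
    have hψ1 : m s * b ≤ 1 := (hψle s _).trans (mul_le_one₀ hk₁1 (Real.exp_pos _).le he1)
    have hy1 := (abs_lt.1 hy).1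
    have hsq : A s y ^ 2 ≤ CA := by
      refine (hA s hs y).trans
        (mul_le_mul_of_nonneg_left (Real.exp_le_exp.2 ?_) hC.le)
      nlinarith
    have hAlow : kA ^ 2 * Real.exp (-(2 * μ * s)) ≤ A s y ^ 2 := by
      have h1 := pow_le_pow_left₀ (by positivity) (hAge s hs y hy.le) 2
      refine le_trans (le_of_eq ?_) h1
      rw [mul_pow, ← Real.exp_nat_mul]
      congr 2; push_cast; ring
    have hsrc : (Q + 6 * CA + 1) * (m s * b) ≤ 2 * g * A s y ^ 2 := by
      calc (Q + 6 * CA + 1) * (m s * b)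
          ≤ (Q + 6 * CA + 1) * (k₁ * Real.exp (-(2 * μ * s))) :=
            mul_le_mul_of_nonneg_left (hψle s _) (by positivity)
        _ = (Q + 6 * CA + 1) * k₁ * Real.exp (-(2 * μ * s)) := by ring
        _ ≤ 2 * g * kA ^ 2 * Real.exp (-(2 * μ * s)) :=
            mul_le_mul_of_nonneg_right hk₁s (Real.exp_pos _).le
        _ = 2 * g * (kA ^ 2 * Real.exp (-(2 * μ * s))) := by ring
        _ ≤ _ := mul_le_mul_of_nonneg_left hAlow (by positivity)
    have h1 : A s y ^ 2 * V s y ≤ CA * (m s * b) :=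
      mul_le_mul hsq hlt.le hV0 hCA0.le
    have h2 : V s y ^ 3 ≤ m s * b := by
      have hV1 : V s y ≤ 1 := hlt.le.trans hψ1
      calc V s y ^ 3 ≤ V s y := by
            simpa using pow_le_pow_of_le_one hV0 hV1 (by norm_num : 1 ≤ 3)
        _ ≤ _ := hlt.le
    have h3 : 0 ≤ α * V s y := mul_nonneg h.α_pos.le hV0
    have h4 : 0 ≤ μ * (m s * b) := mul_nonneg hμ0.le hψ0
    have h5 : (-(2 * μ) * m s + Q * m s) * b = Q * (m s * b) - 2 * (μ * (m s * b)) := by ring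
    rw [h5, h.V_eq s hs y]
    linarith

/-- Growth of `V` in a frame of speed `c` where `A² ≤ κ`: below a cap `δ` the rate is at least
`α - 6κ - δ² - c²/(4d) - 10d/L²`. -/
lemma V_growth (h : ReflectedSolution d α g V Vt Vx Vxx A At Ax Axx V0 A0)
    {t₀ T c L X κ δ ρ m₀ : ℝ} (ht₀ : 0 < t₀) (hL : 0 < L) (hρ : 0 ≤ ρ) (hm₀ : 0 ≤ m₀)
    (hκ : 0 ≤ κ) (hrate : ρ + c ^ 2 / (4 * d) + 10 * d / L ^ 2 ≤ α - 6 * κ - δ ^ 2)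
    (hcap : m₀ * Real.exp (ρ * (T - t₀)) * Real.exp (|c / (2 * d)| * L) ≤ δ)
    (hA : ∀ t, t₀ < t → t ≤ T → ∀ x, |x - X - c * t| < L → A t x ^ 2 ≤ κ)
    (hinit : ∀ x, |x - X - c * t₀| < L →
      m₀ * bump (c / (2 * d)) L (x - X - c * t₀) ≤ V t₀ x) (hT : t₀ < T) (x : ℝ) :
    m₀ * Real.exp (ρ * (T - t₀)) * bump (c / (2 * d)) L (x - X - c * T) ≤ V T x := by
  have hd := h.d_pos
  set m : ℝ → ℝ := fun t => m₀ * Real.exp (ρ * (t - t₀)) with hm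
  have hm0 : ∀ t, 0 ≤ m t := fun t => by positivity
  have hmd : ∀ t, HasDerivAt m (ρ * m t) t := by
    intro t
    have e1 : HasDerivAt (fun t : ℝ => ρ * (t - t₀)) ρ t := by
      simpa using ((hasDerivAt_id t).sub_const t₀).const_mul ρ
    exact HasDerivAt.congr_deriv (f := _) (e1.exp.const_mul m₀) (by simp only [hm]; ring)
  have hmc : Continuous fun t => ρ * m t := by simp only [hm]; fun_prop
  refine bump_le_of_supersolution (D := d) (c := c) (X := X) (K := α) (T := T)
    hd hL h.α_pos.le hmd hmc hm0 (h.V_cl.mono ht₀.le) (fun t ht => h.V_nonneg t (ht₀.trans ht))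
    (h.V_cl.attainsData ht₀) (h.V_nonneg t₀ ht₀)
    (fun y hy => ?_) (fun s hs hsT y hy hlt => ?_) hT le_rfl x
  · simpa [hm] using hinit y hy
  · set b := bump (c / (2 * d)) L (y - X - c * s) with hb
    have hV0 := h.V_nonneg s (ht₀.trans hs) y
    have hδ : m s * b ≤ δ := by
      refine le_trans (mul_le_mul ?_ (bump_le_exp hL) (bump_nonneg _ _ _) (by positivity)) hcap
      exact mul_le_mul_of_nonneg_left (Real.exp_le_exp.2
        (mul_le_mul_of_nonneg_left (by linarith) hρ)) hm₀
    have hVδ : V s y ^ 2 ≤ δ ^ 2 := pow_le_pow_left₀ hV0 (hlt.le.trans hδ) 2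
    have h1 := mul_le_mul_of_nonneg_right hVδ hV0
    have h2 := mul_le_mul_of_nonneg_right (hA s hs hsT y hy) hV0
    have h3 := mul_le_mul_of_nonneg_right hrate (hV0.trans hlt.le)
    have h4 : 0 ≤ (6 * κ + δ ^ 2) * (m s * b - V s y) := mul_nonneg (by positivity) (by linarith)
    have h5 := mul_nonneg h.g_pos.le (sq_nonneg (A s y))
    rw [h.V_eq s (ht₀.trans hs) y]
    nlinarith

/-- The invaded region contains the end point of the optimal path: speed `4p` during time `τ`,
then speed `2dp` during time `rτ`, then a fixed time for saturation. The duration `rτ` is what the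
growth rate `α - dp² - η` needs to compensate the initial size `e^{-2(p² - 1 + η)τ}`. -/
lemma exists_invaded (h : ReflectedSolution d α g V Vt Vx Vxx A At Ax Axx V0 A0) {p η r : ℝ}
    (hp : 1 < p) (hα : 2 < α) (hη : 0 < η) (hη1 : η ≤ 1) (hηp : η < α - d * p ^ 2)
    (hr : (α - d * p ^ 2 - η) * r = 2 * (p ^ 2 - 1 + η))
    (hS : 4 * (1 + r) < 4 * p + 2 * d * p * r) :
    ∃ X T₄ τ₀ : ℝ, ∀ τ ≥ τ₀,
      Real.sqrt (α - 2) < V ((1 + r) * τ + T₄) (X + (4 * p + 2 * d * p * r) * τ) := by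
  have hd := h.d_pos
  set ρ := α - d * p ^ 2 - η with hρ
  have hρ0 : 0 < ρ := by rw [hρ]; linarith
  have hr0 : 0 < r := by
    have : 0 < ρ * r := by rw [hr]; nlinarith
    exact pos_of_mul_pos_right this hρ0.le
  -- a width for which the losses `10D/L²` of all phases fit into the slack `η`
  set L := 1 + (40 + 3200 * d) / η with hL
  have hL1 : 1 ≤ L := by
    have : 0 ≤ (40 + 3200 * d) / η := by positivity
    rw [hL]; linarith
  have hL0 : 0 < L := by linarith
  have hLη : (40 + 3200 * d) / L ^ 2 ≤ η := by
    rw [div_le_iff₀ (by positivity)]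
    have h1 : 40 + 3200 * d ≤ η * L := by
      have : η * L = η + (40 + 3200 * d) := by rw [hL]; field_simp
      linarith
    nlinarith [mul_pos hη hL0]
  have hL40 : 40 / L ^ 2 ≤ η := by
    refine le_trans (div_le_div_of_nonneg_right ?_ (by positivity)) hLη
    linarith
  have hLd : 2560 * d / L ^ 2 ≤ η := by
    refine le_trans (div_le_div_of_nonneg_right ?_ (by positivity)) hLη
    linarith
  obtain ⟨X, k, hk, hV⟩ := h.exists_V_ge hp hη hL0 hL40
  obtain ⟨C, hC, hA⟩ := h.exists_A_sq_le
  set L₃ := L / 4 with hL₃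
  have hL₃0 : 0 < L₃ := by positivity
  set a := 2 * d * p / (2 * d) with ha
  set δ := Real.sqrt η / 2 with hδ
  have hδ0 : 0 < δ := by positivity
  have hδ2 : δ ^ 2 = η / 4 := by rw [hδ, div_pow, Real.sq_sqrt hη.le]; norm_num
  set k₅ := min k δ * Real.exp (-(|a| * L₃)) with hk₅
  have hmin : 0 < min k δ := lt_min hk hδ0
  have hk₅0 : 0 < k₅ := by positivity
  have hk₅e : k₅ * Real.exp (|a| * L₃) = min k δ := by
    rw [hk₅, mul_assoc, ← Real.exp_add, neg_add_cancel, Real.exp_zero, mul_one]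
  set k₆ := k₅ * (27 / 64 * Real.exp (-(|a| * L₃))) with hk₆
  have hk₆0 : 0 < k₆ := by positivity
  -- a cap between the threshold `√(α - 2)` and the equilibrium `√α`
  set M := Real.sqrt (α - 1) with hM
  have hM0 : 0 < M := Real.sqrt_pos.2 (by linarith)
  have hM2 : M ^ 2 = α - 1 := Real.sq_sqrt (by linarith)
  set m₄ := min k₆ (M / 2) with hm₄
  have hm₄0 : 0 < m₄ := lt_min hk₆0 (by positivity)
  set T₄ := 2 * Real.log (M / m₄) with hT₄
  have hT₄0 : 0 < T₄ := by
    refine mul_pos two_pos (Real.log_pos ?_)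
    rw [one_lt_div hm₄0]
    exact (min_le_right _ _).trans_lt (by linarith)
  have hm₄T : m₄ * Real.exp (1 / 2 * T₄) = M := by
    have : 1 / 2 * T₄ = Real.log (M / m₄) := by rw [hT₄]; ring
    rw [this, Real.exp_log (by positivity)]
    field_simp
  set S := 4 * p + 2 * d * p * r with hSdef
  set b := min (4 * p - 4) (S - 4 * (1 + r)) with hb
  have hb0 : 0 < b := lt_min (by linarith) (by linarith)
  have hb1 : b ≤ 4 * p - 4 := min_le_left _ _
  have hb2 : b ≤ S - 4 * (1 + r) := min_le_right _ _
  set κ := η / 24 with hκ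
  -- the whole path stays ahead of the `A` front by a distance that grows with `τ`
  have hev : ∀ᶠ τ : ℝ in atTop, C * Real.exp (-(X - L - 4 * T₄ + b * τ)) ≤ κ := by
    have h1 : Tendsto (fun τ : ℝ => X - L - 4 * T₄ + b * τ) atTop atTop :=
      tendsto_atTop_add_const_left _ _ (tendsto_id.const_mul_atTop hb0)
    have h2 := (Real.tendsto_exp_neg_atTop_nhds_zero.comp h1).const_mul C
    rw [mul_zero] at h2
    exact (h2.eventually_le_const (show 0 < κ by positivity)).mono fun τ h => h
  obtain ⟨τ₀, hτ₀⟩ := eventually_atTop.1 (hev.and (eventually_gt_atTop 0))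
  refine ⟨X, T₄, τ₀, fun τ hτ => ?_⟩
  obtain ⟨hsmall, hτ0⟩ := hτ₀ τ hτ
  have hAκ : ∀ t > 0, ∀ x, X - L - 4 * T₄ + b * τ ≤ x - 4 * t → A t x ^ 2 ≤ κ :=
    fun t ht x hx => (hA t ht x).trans (le_trans (mul_le_mul_of_nonneg_left
      (Real.exp_le_exp.2 (neg_le_neg hx)) hC.le) hsmall)
  set T := (1 + r) * τ with hT
  have hrτ : 0 < r * τ := mul_pos hr0 hτ0
  have hTτ : T - τ = r * τ := by rw [hT]; ring
  have hexp : ρ * (T - τ) = 2 * (p ^ 2 - 1 + η) * τ := by rw [hTτ, ← hr]; ring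
  set m₃ := k₅ * Real.exp (-(2 * (p ^ 2 - 1 + η) * τ)) with hm₃
  have hm₃T : m₃ * Real.exp (ρ * (T - τ)) = k₅ := by
    rw [hm₃, hexp, mul_assoc, ← Real.exp_add, neg_add_cancel, Real.exp_zero, mul_one]
  -- after the second phase, `V` has a size independent of `τ` on an interval of fixed length
  have hplateau : ∀ x, |x - X - S * τ| ≤ L₃ / 2 → k₆ ≤ V T x := by
    intro x hx
    have key := h.V_growth (t₀ := τ) (T := T) (c := 2 * d * p) (L := L₃)
      (X := X + 4 * p * τ - 2 * d * p * τ) (κ := κ) (δ := δ) (ρ := ρ) (m₀ := m₃) hτ0 hL₃0 hρ0.le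
      (by positivity) (by positivity) ?_ ?_ ?_ ?_ (by linarith) x
    · rw [hm₃T, ← ha] at key
      refine le_trans (mul_le_mul_of_nonneg_left (exp_le_bump hL₃0 ?_) hk₅0.le) key
      refine le_trans (le_of_eq ?_) hx
      congr 1
      rw [hSdef, hT]; ring
    · have e1 : (2 * d * p) ^ 2 / (4 * d) = d * p ^ 2 := by field_simp; ring
      have e2 : 10 * d / L₃ ^ 2 = 2560 * d / L ^ 2 / 16 := by rw [hL₃]; field_simp; ring
      rw [e1, e2, hδ2, hκ, hρ]
      linarith
    · rw [hm₃T, ← ha, hk₅e]; exact min_le_right _ _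
    · intro t ht htT y hy
      refine hAκ t (hτ0.trans ht) y ?_
      have hy1 := (abs_lt.1 hy).1
      have hbτ : b * τ ≤ (4 * p - 4) * τ + (2 * d * p - 4) * (t - τ) :=
        two_speed_path_ahead hτ0.le (by linarith) (by linarith) hb1 hb2
      have hL34 : L₃ ≤ L := by rw [hL₃]; linarith
      linarith
    · intro y hy
      rw [← ha]
      have e : y - (X + 4 * p * τ - 2 * d * p * τ) - 2 * d * p * τ = y - X - 4 * p * τ := by ring
      rw [e] at hy ⊢
      refine le_trans ?_ (hV τ hτ0 y hy.le)
      calc m₃ * bump a L₃ (y - X - 4 * p * τ) ≤ m₃ * Real.exp (|a| * L₃) :=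
            mul_le_mul_of_nonneg_left (bump_le_exp hL₃0) (by positivity)
        _ = k₅ * Real.exp (|a| * L₃) * Real.exp (-(2 * (p ^ 2 - 1 + η) * τ)) := by
            rw [hm₃]; ring
        _ ≤ _ := by
            rw [hk₅e]
            exact mul_le_mul_of_nonneg_right (min_le_left _ _) (Real.exp_pos _).le
  have hT0 : 0 < T := by rw [hT]; positivity
  -- saturation: a bump at rest grows to the cap within the fixed time `T₄`
  have key := h.V_growth (t₀ := T) (T := T + T₄) (c := 0) (L := L₃ / 2) (X := X + S * τ)
    (κ := κ) (δ := M) (ρ := 1 / 2) (m₀ := m₄) hT0 (by positivity) (by norm_num) hm₄0.le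
    (by positivity) ?_ ?_ ?_ ?_ (by linarith) (X + S * τ)
  · have e : T + T₄ - T = T₄ := by ring
    have hb1 : bump (0 / (2 * d)) (L₃ / 2) (X + S * τ - (X + S * τ) - 0 * (T + T₄)) = 1 := by
      simp [bump]
    rw [e, hm₄T, hb1, mul_one] at key
    exact (Real.sqrt_lt_sqrt (by linarith) (by linarith)).trans_le key
  · have e2 : 10 * d / (L₃ / 2) ^ 2 = 2560 * d / L ^ 2 / 4 := by rw [hL₃]; field_simp; ring
    rw [e2, hM2, hκ]
    norm_num
    linarith
  · have e : T + T₄ - T = T₄ := by ring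
    rw [e, hm₄T]; simp
  · intro t ht htT y hy
    refine hAκ t (hT0.trans ht) y ?_
    have hy1 := (abs_lt.1 hy).1
    have h3 := mul_le_mul_of_nonneg_right hb2 hτ0.le
    have hL34 : L₃ / 2 ≤ L := by rw [hL₃]; linarith
    have e : (S - 4 * (1 + r)) * τ = S * τ - 4 * T := by rw [hT]; ring
    linarith
  · intro y hy
    have e : y - (X + S * τ) - 0 * T = y - X - S * τ := by ring
    rw [e] at hy ⊢
    refine le_trans ?_ (hplateau y hy.le)
    calc m₄ * bump (0 / (2 * d)) (L₃ / 2) (y - X - S * τ)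
        ≤ m₄ * Real.exp (|0 / (2 * d)| * (L₃ / 2)) :=
          mul_le_mul_of_nonneg_left (bump_le_exp (by positivity)) hm₄0.le
      _ = m₄ := by simp
      _ ≤ k₆ := min_le_left _ _

end ReflectedSolution

/-! ### Two-sided bounds on the invasion speed -/

/-- As `η → 0`, the speed of the two-phase path tends to `dp + α/p`. -/
lemma tendsto_two_speed {p : ℝ} {d α : ℝ} (hp : 0 < p) (hd2 : d < 2)
    (hres : d * p ^ 2 + α = 2 * p ^ 2 + 2) (hlam : 0 < α - d * p ^ 2) :
    Tendsto (fun η => (4 * p + 2 * d * p * (2 * (p ^ 2 - 1 + η) / (α - d * p ^ 2 - η))) /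
      (1 + 2 * (p ^ 2 - 1 + η) / (α - d * p ^ 2 - η))) (𝓝[>] 0) (𝓝 (d * p + α / p)) := by
  have hα : α = 2 * p ^ 2 + 2 - d * p ^ 2 := by linarith
  have h2d : 0 < 2 - d := by linarith
  have hden : α - d * p ^ 2 + 2 * (p ^ 2 - 1) = 2 * p ^ 2 * (2 - d) := by rw [hα]; ring
  have h0 : 1 + 2 * (p ^ 2 - 1 + 0) / (α - d * p ^ 2 - 0) =
      2 * p ^ 2 * (2 - d) / (α - d * p ^ 2) := by
    rw [← hden, add_zero, sub_zero, add_div, div_self hlam.ne']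
  have h0' : 1 + 2 * (p ^ 2 - 1 + 0) / (α - d * p ^ 2 - 0) ≠ 0 := by rw [h0]; positivity
  have hc : ContinuousAt (fun η => (4 * p + 2 * d * p * (2 * (p ^ 2 - 1 + η) /
      (α - d * p ^ 2 - η))) / (1 + 2 * (p ^ 2 - 1 + η) / (α - d * p ^ 2 - η))) 0 := by
    have hr : ContinuousAt (fun η => 2 * (p ^ 2 - 1 + η) / (α - d * p ^ 2 - η)) 0 :=
      ContinuousAt.div (by fun_prop) (by fun_prop) (by rw [sub_zero]; exact hlam.ne')
    exact (continuousAt_const.add (continuousAt_const.mul hr)).div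
      (continuousAt_const.add hr) h0'
  have hval : (4 * p + 2 * d * p * (2 * (p ^ 2 - 1 + 0) / (α - d * p ^ 2 - 0))) /
      (1 + 2 * (p ^ 2 - 1 + 0) / (α - d * p ^ 2 - 0)) = d * p + α / p := by
    have hnum : 4 * p * (α - d * p ^ 2) + 4 * d * p * (p ^ 2 - 1) =
        4 * p * (p ^ 2 + 1) * (2 - d) := by rw [hα]; ring
    have hsum : d * p + α / p = (2 * p ^ 2 + 2) / p := by rw [← hres]; field_simp
    have e : 4 * p + 2 * d * p * (2 * (p ^ 2 - 1) / (α - d * p ^ 2)) =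
        4 * p * (p ^ 2 + 1) * (2 - d) / (α - d * p ^ 2) := by
      rw [← hnum, add_div, mul_div_assoc (4 * p), div_self hlam.ne']; ring
    rw [h0, add_zero, sub_zero, e, hsum, div_div_div_cancel_right₀ hlam.ne']
    have h2d' := h2d.ne'
    field_simp
    ring
  have := hc.tendsto.mono_left (nhdsWithin_le_nhds (s := Set.Ioi 0))
  rw [hval] at this
  exact this

namespace ReflectedSolution

variable {d α g : ℝ} {V Vt Vx Vxx A At Ax Axx : ℝ → ℝ → ℝ} {V0 A0 : ℝ → ℝ}

lemma eventually_le_of_invaded (h : ReflectedSolution d α g V Vt Vx Vxx A At Ax Axx V0 A0)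
    {p s θ ε : ℝ} (hp : 0 < p) (hres : d * p ^ 2 + α = 2 * p ^ 2 + 2)
    (hs : d * p ^ 2 + α = p * s) (hθ : 0 < θ) (hε : 0 < ε) :
    ∀ᶠ t in atTop, ∀ x, θ < V t x → x ≤ (s + ε) * t := by
  obtain ⟨C, hC, B, hB, hV⟩ := h.exists_V_le hp hres
  set k := p * ε with hk
  have hk0 : 0 < k := mul_pos hp hε
  have hkt : Tendsto (fun t : ℝ => k * t) atTop atTop := tendsto_id.const_mul_atTop hk0
  have hlim : Tendsto (fun t : ℝ => (C + B * t) * Real.exp (-(k * t))) atTop (𝓝 0) := by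
    have h1 := (Real.tendsto_exp_neg_atTop_nhds_zero.comp hkt).const_mul C
    have h2 := ((Real.tendsto_pow_mul_exp_neg_atTop_nhds_zero 1).comp hkt).const_mul (B / k)
    have h3 := h1.add h2
    rw [mul_zero, mul_zero, add_zero] at h3
    refine h3.congr fun t => ?_
    simp only [Function.comp_apply]
    field_simp
  filter_upwards [hlim.eventually_lt_const hθ, eventually_gt_atTop 0] with t ht ht0 x hx
  by_contra! hlt
  have h1 : V t x ≤ (C + B * t) * Real.exp (-(k * t)) := by
    refine (hV t ht0 x).trans (mul_le_mul_of_nonneg_left (Real.exp_le_exp.2 ?_) (by positivity))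
    have := mul_le_mul_of_nonneg_left hlt.le hp.le
    rw [hs, hk]
    linarith
  linarith

lemma eventually_exists_invaded (h : ReflectedSolution d α g V Vt Vx Vxx A At Ax Axx V0 A0)
    {p ε : ℝ} (hp : 1 < p) (hd2 : d < 2) (hα : 2 < α)
    (hres : d * p ^ 2 + α = 2 * p ^ 2 + 2) (hlam : 0 < α - d * p ^ 2)
    (h4 : 4 < d * p + α / p) (hε : 0 < ε) :
    ∀ᶠ t in atTop, ∃ x, Real.sqrt (α - 2) < V t x ∧ (d * p + α / p - ε) * t ≤ x := by
  have hd := h.d_pos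
  have hF := tendsto_two_speed (by linarith) hd2 hres hlam
  obtain ⟨η, ⟨⟨hF4, hFs⟩, hη0, hηlt⟩⟩ := ((hF.eventually_const_lt h4).and
    (hF.eventually_const_lt (show d * p + α / p - ε < d * p + α / p by linarith)) |>.and
    (Ioo_mem_nhdsGT (lt_min one_pos hlam))).exists
  have hη1 : η ≤ 1 := hηlt.le.trans (min_le_left _ _)
  have hηl : η < α - d * p ^ 2 := hηlt.trans_le (min_le_right _ _)
  have hρ0 : 0 < α - d * p ^ 2 - η := by linarith
  set r := 2 * (p ^ 2 - 1 + η) / (α - d * p ^ 2 - η) with hr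
  have hr0 : 0 < r := div_pos (by nlinarith) hρ0
  have h1r : 0 < 1 + r := by linarith
  obtain ⟨X, T₄, τ₀, hinv⟩ := h.exists_invaded (r := r) hp hα hη0 hη1 hηl
    (by rw [hr]; field_simp) (by rwa [lt_div_iff₀ h1r] at hF4)
  set S := 4 * p + 2 * d * p * r with hS
  set s := d * p + α / p - ε with hs
  have hτ : Tendsto (fun t : ℝ => (t - T₄) / (1 + r)) atTop atTop :=
    (tendsto_atTop_add_const_right _ (-T₄) tendsto_id).atTop_div_const h1r
  have hgap : Tendsto (fun t : ℝ => (S / (1 + r) - s) * t) atTop atTop :=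
    tendsto_id.const_mul_atTop (by linarith)
  filter_upwards [hτ.eventually_ge_atTop τ₀, hgap.eventually_ge_atTop (S / (1 + r) * T₄ - X)]
    with t ht1 ht2
  refine ⟨X + S * ((t - T₄) / (1 + r)), ?_, ?_⟩
  · have e : (1 + r) * ((t - T₄) / (1 + r)) + T₄ = t := by field_simp; ring
    have := hinv _ ht1
    rwa [e] at this
  · have e : S * ((t - T₄) / (1 + r)) = S / (1 + r) * t - S / (1 + r) * T₄ := by ring
    rw [e]
    linarith

end ReflectedSolution

/-- A family of sets whose elements are eventually at most `(s + ε)t`, with some element at least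
`(s - ε)t`, has suprema asymptotic to `st`. -/
lemma tendsto_sSup_div {I : ℝ → Set ℝ} {s : ℝ}
    (hup : ∀ ε > 0, ∀ᶠ t in atTop, ∀ x ∈ I t, x ≤ (s + ε) * t)
    (hlow : ∀ ε > 0, ∀ᶠ t in atTop, ∃ x ∈ I t, (s - ε) * t ≤ x) :
    (∀ᶠ t in atTop, (I t).Nonempty ∧ BddAbove (I t)) ∧
      Tendsto (fun t => sSup (I t) / t) atTop (𝓝 s) := by
  constructor
  · filter_upwards [hup 1 one_pos, hlow 1 one_pos] with t h1 ⟨x, hx, _⟩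
    exact ⟨⟨x, hx⟩, ⟨_, h1⟩⟩
  · rw [Metric.tendsto_nhds]
    intro ε hε
    filter_upwards [hup (ε / 2) (half_pos hε), hlow (ε / 2) (half_pos hε),
      eventually_gt_atTop 0] with t h1 ⟨x, hx, hxt⟩ ht
    have hge : (s - ε / 2) * t ≤ sSup (I t) := hxt.trans (le_csSup ⟨_, h1⟩ hx)
    have hle : sSup (I t) ≤ (s + ε / 2) * t := csSup_le ⟨x, hx⟩ h1
    rw [← le_div_iff₀ ht] at hge
    rw [← div_le_iff₀ ht] at hle
    rw [Real.dist_eq, abs_lt]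
    constructor <;> linarith

/-- In the parameter region the resonant decay rate `p = √((α - 2)/(2 - d))` exceeds `1`, satisfies
`dp² < α`, and gives the speed `s_AU = dp + α/p`. -/
lemma exists_resonant_rate {d α : ℝ} (hP : (d, α) ∈ regionP) :
    0 < d ∧ d < 2 ∧ 2 < α ∧ ∃ p : ℝ, 1 < p ∧ d * p ^ 2 + α = 2 * p ^ 2 + 2 ∧
      0 < α - d * p ^ 2 ∧ speedAU d α = d * p + α / p := by
  have hd : 0 < d ∧ d < 2 ∧ 4 - d < α ∧ α * (d - 1) < d := by
    rcases hP with ⟨h1, h2, h3⟩ | ⟨h1, h2, h3, h4⟩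
    · simp only at h1 h2 h3
      exact ⟨h1, by linarith, h3, by nlinarith⟩
    · simp only at h1 h2 h3 h4
      exact ⟨by linarith, h2, h3, (lt_div_iff₀ (by linarith)).1 h4⟩
  obtain ⟨hd0, hd2, hα, hαd⟩ := hd
  have h2d : 0 < 2 - d := by linarith
  have hα2 : 0 < α - 2 := by linarith
  set p := Real.sqrt ((α - 2) / (2 - d)) with hp
  have hp2 : p ^ 2 * (2 - d) = α - 2 := by
    rw [hp, Real.sq_sqrt (by positivity)]; field_simp
  have hp1 : 1 < p := by
    rw [hp, Real.lt_sqrt zero_le_one, one_pow, one_lt_div h2d]; linarith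
  have hlam : 0 < α - d * p ^ 2 := by
    have e : (2 - d) * (α - d * p ^ 2) = 2 * (d - α * (d - 1)) := by
      linear_combination (-d) * hp2
    refine pos_of_mul_pos_right (a := 2 - d) ?_ h2d.le
    rw [e]; linarith
  have hspeed : speedAU d α = d * p + α / p := by
    rw [speedAU, ← inv_div (α - 2), Real.sqrt_inv, ← hp, div_eq_mul_inv]
  exact ⟨hd0, hd2, by linarith, p, hp1, by linarith, hlam, hspeed⟩

/-- The two inequalities are strict cases of the arithmetic-geometric mean inequality. -/
lemma max_speed_lt_speedAU {d α : ℝ} (hP : (d, α) ∈ regionP) :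
    max speedA (speedU d α) < speedAU d α := by
  obtain ⟨hd, hd2, hα, p, hp, hres, hlam, hs⟩ := exists_resonant_rate hP
  have hp0 : 0 < p := by linarith
  rw [hs]
  refine max_lt ?_ ?_
  · have e : d * p + α / p = (2 * p ^ 2 + 2) / p := by rw [← hres]; field_simp
    rw [e, speedA, lt_div_iff₀ hp0]
    nlinarith [sq_pos_of_pos (show 0 < p - 1 by linarith)]
  · have hpos : 0 < d * p + α / p := by positivity
    have hne : 0 < α / p - d * p := by
      have e : α / p - d * p = (α - d * p ^ 2) / p := by field_simp
      rw [e]; positivity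
    have e : (d * p + α / p) ^ 2 - 4 * (d * α) = (α / p - d * p) ^ 2 := by field_simp; ring
    have h1 : Real.sqrt (d * α) < (d * p + α / p) / 2 := by
      rw [Real.sqrt_lt' (by positivity)]
      nlinarith [sq_pos_of_pos hne]
    rw [speedU]; linarith

theorem theorem1 (d α γ : ℝ) (hP : (d, α) ∈ regionP) (hγ : γ ≠ 0) :
    max speedA (speedU d α) < speedAU d α ∧
    ∀ (U0 A0 : ℝ → ℝ) (U A : ℝ → ℝ → ℝ),
      -- for `γ < 0` the component `U` is reflected; for `γ > 0` the sign factor is `1`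
      IsPerturbedStep (fun x => Real.sign γ * U0 x) →
      IsPerturbedStep A0 →
      IsSolution d α γ U A U0 A0 →
      (∀ᶠ t in atTop, (invadedSet α (fun s x => Real.sign γ * U s x) t).Nonempty ∧
        BddAbove (invadedSet α (fun s x => Real.sign γ * U s x) t)) ∧
      Tendsto (fun t => invasionPoint α (fun s x => Real.sign γ * U s x) t / t) atTop
        (𝓝 (speedAU d α)) := by
  refine ⟨max_speed_lt_speedAU hP, fun U0 A0 U A hU0 hA0 hsol => ?_⟩
  have hmax := max_speed_lt_speedAU hP
  obtain ⟨hd, hd2, hα, p, hp, hres, hlam, hs⟩ := exists_resonant_rate hP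
  have hp0 : 0 < p := by linarith
  have href := hsol.reflected hd (by linarith) hγ hU0 hA0
  have h4 : 4 < d * p + α / p := by
    rw [← hs]; exact (le_max_left _ _).trans_lt hmax
  refine tendsto_sSup_div (fun ε hε => ?_) (fun ε hε => ?_)
  · exact href.eventually_le_of_invaded hp0 hres (by rw [hs]; field_simp)
      (Real.sqrt_pos.2 (by linarith)) hε
  · rw [hs]
    exact href.eventually_exists_invaded hp hd2 hα hres hlam h4 hε
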